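/- **Conventions.** A signed graph $\Sigma=(V,E,\sigma)$ has a finite vertex set $V$, a finite edge set $E$, and a sign function $\sigma:E\to\{-1,1\}$. Every edge has two ends, each attached to one vertex or to none, and at least one end is attached; loops and multiple edges are allowed, and an edge with an unattached end is an *outer-edge*. A *circle* is a connected 2-regular subgraph (a loop counts $2$ in the degree) without outer-edges; its sign is the product of its edge signs. A component is *compact* if it has no outer-edges, and *balanced* if it is compact and all its circles are positive. Let $b(\Sigma)$ and $u_c(\Sigma)$ be the numbers of balanced components and of compact unbalanced components, and let ${\rm cr}(\Sigma)=|E|-(|V|-b(\Sigma))$. An *arc* is an edge $e$ together with an arrow at each of its two ends, the two arrows having the same direction along $e$ if $\sigma(e)=1$ and opposite directions if $\sigma(e)=-1$; so each edge has exactly two orientations $\vec e$ and $\vec e^{\,-1}$. The incidence number $[v,\vec e\,]$ is the number of arrows of $\vec e$ at ends attached to $v$ that point to $v$, minus the number of those that point away from $v$. For an abelian group $\mathbb A$, a *1-chain* is a function ${\bf c}$ from arcs to $\mathbb A$ with ${\bf c}(\vec e^{\,-1})=-{\bf c}(\vec e\,)$, and the *flow group* ${\rm F}(\Sigma,\mathbb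 A)$ is the group of the 1-chains with $\sum_{e\in E}[v,\vec e\,]\,{\bf c}(\vec e\,)=0$ for all $v\in V$. Put ${\rm Tor}_2(\mathbb A)=\{a\in\mathbb A: 2a=0\}$. For an orientation $\omega(S)$ of an edge set $S$, let ${\bf 1}_{\omega(S)}$ be the integral 1-chain with value $1$ on the arcs of $\omega(S)$ and $0$ on the edges outside $S$. A *circuit* is a minimal nonempty edge set $C$ that is the support of a real flow ${\bf f}$; a *direction* of $C$ is $\omega(C)=\{\vec e:{\bf f}(\vec e\,)>0\}$ for such an ${\bf f}$. An edge of a circuit $C$ is *double* if $C$ contains a negative circle and the edge lies on no circle contained in $C$ (these are the edges of the half-line or line segment attached to the negative circles of $C$); the other edges of $C$ are *single*. Let ${\bf I}_{\omega(C)}$ be the integral 1-chain with value $1$ on the single arcs and $2$ on the double arcs of $\omega(C)$, and $0$ on the edges outside $C$. A *canonical base* of $\Sigma$ is an edge set $B$ that consists, in each component $\Sigma_i$, of a spanning tree $T_i$ of $\Sigma_i$ with its outer-edges removed, together with: no further edge if $\Sigma_i$ is balanced; one outer-edge of $\Sigma_i$ if $\Sigma_i$ has outer-edges; one edge $e_i$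 of $\Sigma_i$ such that the unique circle contained in $T_i\cup e_i$ is negative if $\Sigma_i$ is compact and unbalanced. **Theorem (Characterization of the flow group).** Let $\Sigma$ be a signed graph, $\mathbb A$ an abelian group, $B$ a canonical base of $\Sigma$, and $B^c=E\smallsetminus B$. For each $e\in B^c$ there is a unique circuit $C_e$ contained in $B\cup\{e\}$. Let $C_\rho$ range over all negative circles contained in $B$. For all choices of orientations $\omega(C_\rho)$ of the circles $C_\rho$ and of directions $\omega(C_e)$ of the circuits $C_e$, $$ {\rm F}(\Sigma,\mathbb A)=\Big(\bigoplus_{\rho}{\rm Tor}_2(\mathbb A)\cdot{\bf 1}_{\omega(C_\rho)}\Big)\oplus\Big(\bigoplus_{e\in B^c}\mathbb A\cdot{\bf I}_{\omega(C_e)}\Big) $$ as an internal direct sum of subgroups of the group of 1-chains. Moreover ${\rm cr}(\Sigma)=|B^c|$ and $$ {\rm F}(\Sigma,\mathbb A)\cong({\rm Tor}_2\mathbb A)^{u_c(\Sigma)}\oplus\mathbb A^{{\rm cr}(\Sigma)} . $$ -/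

import Mathlib

/-- A signed graph (possibly with loops, parallel edges and outer-edges) on the vertex set `V` and
the edge set `E`. Every edge `e` has two ends, labelled by `Bool`; each end is attached to a vertex
(`some v`) or to no vertex (`none`), and at least one end is attached to a vertex. -/
structure SignedGraph (V E : Type*) where
  endpt : E → Bool → Option V
  attached : ∀ e, ∃ i, endpt e i ≠ none
  sign : E → ℤˣ

namespace SignedGraph

variable {V E : Type*} (G : SignedGraph V E)

/-! ### Vertices, edges, components, circles -/

/-- `v` is an endpoint of the edge `e`. -/
def IsEndpoint (v : V) (e : E) : Prop := ∃ i, G.endpt e i = some v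

/-- An outer-edge: one of its two ends is attached to no vertex. -/
def IsOuter (e : E) : Prop := ∃ i, G.endpt e i = none

/-- The degree of `v` in the subgraph with edge set `S`: the number of ends at `v` of edges of `S`
(so a loop counts twice). -/
noncomputable def degree (S : Set E) (v : V) : ℕ :=
  {p : E × Bool | p.1 ∈ S ∧ G.endpt p.1 p.2 = some v}.ncard

/-- The simple graph on `V` in which two distinct vertices are adjacent when they are joined by an
edge of `S`. Its reachability relation is connectedness in the spanning subgraph `(V, S)`. -/
def linkGraph (S : Set E) : SimpleGraph V where
  Adj u v := u ≠ v ∧ ∃ e ∈ S, ∃ i, G.endpt e i = some u ∧ G.endpt e (!i) = some v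
  symm := ⟨fun _ _ h => ⟨h.1.symm, by
    obtain ⟨-, e, he, i, hu, hv⟩ := h
    exact ⟨e, he, !i, hv, by simpa using hu⟩⟩⟩
  loopless := ⟨fun _ h => h.1 rfl⟩

/-- The connected components of the signed graph, given by their vertex sets. (Every edge has an
endpoint, so every component contains a vertex.) -/
abbrev Component := (G.linkGraph Set.univ).ConnectedComponent

/-- The set of edges of a component: links, loops and outer-edges. -/
def edgesOf (K : G.Component) : Set E := {e | ∃ v ∈ K.supp, G.IsEndpoint v e}

/-- A circle, given by its edge set: a connected 2-regular subgraph without outer-edges. Its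
vertices are the endpoints of its edges. -/
structure IsCircle (C : Set E) : Prop where
  nonempty : C.Nonempty
  no_outer : ∀ e ∈ C, ¬ G.IsOuter e
  regular : ∀ e ∈ C, ∀ v, G.IsEndpoint v e → G.degree C v = 2
  connected : ∀ e ∈ C, ∀ e' ∈ C, ∀ u v, G.IsEndpoint u e → G.IsEndpoint v e' →
    (G.linkGraph C).Reachable u v

/-- The sign of a set of edges: the product of the signs of its edges. -/
noncomputable def signOf (C : Set E) : ℤˣ := ∏ᶠ e ∈ C, G.sign e

/-- A circle of sign `-1`. -/
def IsNegativeCircle (C : Set E) : Prop := G.IsCircle C ∧ G.signOf C = -1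

/-- The component contains no outer-edge. -/
def IsCompact (K : G.Component) : Prop := ∀ e ∈ G.edgesOf K, ¬ G.IsOuter e

/-- A component is balanced if it contains no outer-edge and all its circles are positive. -/
def IsBalanced (K : G.Component) : Prop :=
  G.IsCompact K ∧ ∀ C ⊆ G.edgesOf K, G.IsCircle C → G.signOf C = 1

/-- The number of balanced components. -/
noncomputable def numBalanced : ℕ := Nat.card {K : G.Component // G.IsBalanced K}

/-- The number of compact unbalanced components. -/
noncomputable def numCompactUnbalanced : ℕ :=
  Nat.card {K : G.Component // G.IsCompact K ∧ ¬ G.IsBalanced K}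

/-- The rank `|V| - b`, where `b` is the number of balanced components (so `b ≤ |V|`). -/
noncomputable def rank : ℕ := Nat.card V - G.numBalanced

/-- The cycle-rank: the number of edges minus the rank. -/
noncomputable def cycleRank : ℕ := Nat.card E - G.rank

/-! ### Canonical bases -/

/-- `T` is the edge set of a spanning tree of the component `K` with its outer-edges removed. -/
structure IsSpanningTree (K : G.Component) (T : Set E) : Prop where
  subset : T ⊆ G.edgesOf K
  no_outer : ∀ e ∈ T, ¬ G.IsOuter e
  acyclic : ∀ C ⊆ T, ¬ G.IsCircle C
  connected : ∀ u ∈ K.supp, ∀ v ∈ K.supp, (G.linkGraph T).Reachable u v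

/-- `B` is a canonical base: in every component `K` it consists of a spanning tree `T`, together
with no further edge if `K` is balanced, with one outer-edge if `K` has outer-edges, and with one
edge `e` such that the (unique) circle contained in `T ∪ {e}` is negative if `K` is unbalanced
without outer-edges. -/
def IsCanonicalBase (B : Set E) : Prop :=
  ∀ K : G.Component, ∃ T, G.IsSpanningTree K T ∧
    ((G.IsBalanced K ∧ B ∩ G.edgesOf K = T) ∨
      (¬ G.IsCompact K ∧ ∃ e ∈ G.edgesOf K, G.IsOuter e ∧ B ∩ G.edgesOf K = insert e T) ∨
      (G.IsCompact K ∧ ¬ G.IsBalanced K ∧ ∃ e ∈ G.edgesOf K,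
        (∃ C ⊆ insert e T, G.IsNegativeCircle C) ∧ B ∩ G.edgesOf K = insert e T))

/-! ### Arcs, chains, flows -/

/-- An orientation of the edge `e` (an arc): an arrow at each of the two ends of `e`. The value
`toward i` is `1` if the arrow at the end `i` points toward that end (to its vertex, or to the
outside), and `-1` if it points away from it. The two arrows have the same direction along `e` (one
toward its end, the other away from its end) if `e` is positive, and opposite directions if `e` is
negative. -/
@[ext] structure Arc (e : E) where
  toward : Bool → ℤˣ
  rule : toward false * toward true = - G.sign e

variable {G}

/-- The opposite arc. -/
def Arc.opp {e : E} (a : G.Arc e) : G.Arc e := ⟨fun i => - a.toward i, by simpa using a.rule⟩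

@[simp] theorem Arc.opp_opp {e : E} (a : G.Arc e) : a.opp.opp = a := by
  ext i; simp [Arc.opp]

theorem Arc.opp_ne {e : E} (a : G.Arc e) : a.opp ≠ a := by
  intro h
  have h1 := congrArg (fun b : G.Arc e => b.toward true) h
  simp only [Arc.opp] at h1
  rcases Int.units_eq_one_or (a.toward true) with h2 | h2 <;> rw [h2] at h1 <;>
    exact absurd h1 (by decide)

/-- Every edge has exactly two orientations, opposite to each other. -/
theorem Arc.eq_or_eq_opp {e : E} (a b : G.Arc e) : a = b ∨ a = b.opp := by
  have ha := a.rule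
  rw [← b.rule] at ha
  rcases Int.units_eq_one_or (a.toward true * b.toward true) with h | h
  · left
    have h1 : a.toward true = b.toward true := by
      rw [mul_eq_one_iff_eq_inv] at h; simpa using h
    have h2 : a.toward false = b.toward false := by
      rw [h1] at ha; exact mul_right_cancel ha
    ext i; cases i <;> simp [h1, h2]
  · right
    have h1 : a.toward true = - b.toward true := by
      have := congrArg (· * b.toward true) h
      simpa [mul_assoc] using this
    have h2 : a.toward false = - b.toward false := by
      rw [h1] at ha
      have h3 : (- a.toward false) * b.toward true = b.toward false * b.toward true := by
        rw [← ha]; simp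
      rw [← mul_right_cancel h3, neg_neg]
    ext i; cases i <;> simp [h1, h2, Arc.opp]

open Classical in
/-- The incidence number `[v, a]`: the sum over the ends of the edge that are attached to `v` of
`1` for an arrow pointing to `v` and `-1` for an arrow pointing away from `v`. Thus it is `±1` at
an endpoint of a link or an outer-edge, `±2` at the vertex of a negative loop, `0` at the vertex
of a positive loop, and `0` if `v` is no endpoint. -/
noncomputable def Arc.incidence {e : E} (v : V) (a : G.Arc e) : ℤ :=
  ∑ i : Bool, if G.endpt e i = some v then (a.toward i : ℤ) else 0

theorem Arc.incidence_opp {e : E} (v : V) (a : G.Arc e) :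
    a.opp.incidence v = - a.incidence v := by
  classical
  simp only [Arc.incidence, Arc.opp, ← Finset.sum_neg_distrib]
  refine Finset.sum_congr rfl fun i _ => ?_
  split_ifs <;> simp

variable (G)

/-- An orientation of the graph: a choice of an arc for every edge. An orientation of a set `S` of
edges is given by its values on `S`. -/
abbrev Orientation := ∀ e : E, G.Arc e

/-- A reference orientation, used only to write down sums over edges that do not depend on it. -/
def refOrientation : G.Orientation := fun e =>
  ⟨fun i => if i then 1 else - G.sign e, by simp⟩

/-- The group of 1-chains over `A`: functions `c` on arcs such that `c (-a) = - c a`. -/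
def Chain (A : Type*) [AddCommGroup A] : AddSubgroup (∀ e : E, G.Arc e → A) where
  carrier := {c | ∀ e (a : G.Arc e), c e a.opp = - c e a}
  add_mem' := by
    intro c d hc hd e a
    simp only [Pi.add_apply, hc e a, hd e a, neg_add]
  zero_mem' := by intro e a; simp
  neg_mem' := by
    intro c hc e a
    simp only [Pi.neg_apply, hc e a]

/-- The support of a 1-chain: the edges on which it does not vanish. -/
def support {A : Type*} [AddCommGroup A] (c : G.Chain A) : Set E :=
  {e | ∃ a : G.Arc e, c.1 e a ≠ 0}

/-- The boundary operator `(∂c)(v) = ∑ₑ [v, e] c(e)`, where each edge is taken with any one of its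
orientations; see `boundary_apply`. -/
noncomputable def boundary [Fintype E] (A : Type*) [AddCommGroup A] :
    G.Chain A →+ (V → A) where
  toFun c v := ∑ e, (G.refOrientation e).incidence v • c.1 e (G.refOrientation e)
  map_zero' := by ext v; simp
  map_add' c d := by ext v; simp [smul_add, Finset.sum_add_distrib]

/-- The boundary does not depend on the chosen orientation. -/
theorem boundary_apply [Fintype E] {A : Type*} [AddCommGroup A] (ω : G.Orientation)
    (c : G.Chain A) (v : V) :
    G.boundary A c v = ∑ e, (ω e).incidence v • c.1 e (ω e) := by
  refine Finset.sum_congr rfl fun e _ => ?_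
  rcases (G.refOrientation e).eq_or_eq_opp (ω e) with h | h
  · rw [h]
  · rw [h, Arc.incidence_opp, c.2 e (ω e), smul_neg, neg_smul, neg_neg]

/-- The flow group `F(Σ, A)`: the kernel of the boundary operator. -/
noncomputable def flow [Fintype E] (A : Type*) [AddCommGroup A] : AddSubgroup (G.Chain A) :=
  (G.boundary A).ker

open Classical in
/-- The integral 1-chain `∑_{e ∈ S} m(e) ω(e)` of the oriented edge multiset `(S, m)`. -/
noncomputable def multisetChain (S : Set E) (m : E → ℤ) (ω : G.Orientation) : G.Chain ℤ :=
  ⟨fun e a => if e ∈ S then (if a = ω e then m e else - m e) else 0, by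
    intro e a
    rcases a.eq_or_eq_opp (ω e) with h | h
    · by_cases he : e ∈ S <;> simp [h, he, Arc.opp_ne]
    · by_cases he : e ∈ S <;> simp [h, he, Arc.opp_ne]⟩

/-- The characteristic chain `1_{ω(S)}` of an oriented edge set. -/
noncomputable def indicatorChain (S : Set E) (ω : G.Orientation) : G.Chain ℤ :=
  G.multisetChain S (fun _ => 1) ω

/-- For an integral chain `c`, the homomorphism `a ↦ a · c` from `A` to the chains over `A`. -/
def scale (A : Type*) [AddCommGroup A] (c : G.Chain ℤ) : A →+ G.Chain A where
  toFun x := ⟨fun e a => c.1 e a • x, by intro e a; simp [c.2 e a]⟩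
  map_zero' := by ext e a; simp
  map_add' x y := by ext e a; simp

/-- The subgroup `Tor₂(A)` of the elements `a` with `2a = 0`. -/
def torTwo (A : Type*) [AddCommGroup A] : AddSubgroup A := (nsmulAddMonoidHom (α := A) 2).ker

/-! ### Circuits -/

/-- A signed-graph circuit, given by its edge set: a minimal nonempty edge set that permits a
nowhere-zero real flow (minimality makes it connected). -/
def IsCircuit [Fintype E] (C : Set E) : Prop :=
  Minimal (fun S : Set E => S.Nonempty ∧ ∃ f ∈ G.flow ℝ, G.support f = S) C

/-- `ω` restricts to a direction of the circuit `C`: for some nowhere-zero real flow `f` on `C`,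
`ω` selects the arcs of `C` on which `f` is positive. -/
def IsDirection [Fintype E] (C : Set E) (ω : G.Orientation) : Prop :=
  ∃ f ∈ G.flow ℝ, G.support f = C ∧ ∀ e ∈ C, 0 < f.1 e (ω e)

/-- The double edges of a circuit `C`. A circuit is an open line, a positive circle, two negative
circles with one common vertex, a negative circle with a half-line, or two disjoint negative circles
connected by a line segment; the double edges are those of the half-line and of the line segment.
These are the edges on no circle of `C`, when `C` contains a negative circle. -/
def IsDouble (C : Set E) (e : E) : Prop :=
  e ∈ C ∧ (∃ D ⊆ C, G.IsNegativeCircle D) ∧ ∀ D ⊆ C, G.IsCircle D → e ∉ D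

open Classical in
/-- The circuit chain `I_{ω(C)}`, with value `2` on the double arcs and `1` on the single arcs of
`ω(C)`. -/
noncomputable def circuitChain (C : Set E) (ω : G.Orientation) : G.Chain ℤ :=
  G.multisetChain C (fun e => if G.IsDouble C e then 2 else 1) ω

/-- `C` is a fundamental circuit of `e` with respect to `B`: a circuit contained in `B ∪ {e}`. -/
def IsFundamentalCircuit [Fintype E] (B : Set E) (e : E) (C : Set E) : Prop :=
  G.IsCircuit C ∧ C ⊆ insert e B

end SignedGraph

/-! In the coordinates of a reference orientation a chain is a function `E → A`, and everything
rests on what a canonical base `B` can carry. The support of a nonzero chain without outer-edges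
whose boundary vanishes off one vertex contains a circle (`exists_isCircle_of_bd_eq_zero`), so a
spanning tree carries no such chain (`IsSpanningTree.eq_zero`). Adding an outer-edge to the tree
still gives no flow. Adding an edge that closes a negative circle gives little: a circle can be
oriented so that its boundary sits at one chosen vertex, where it is ±2 if the circle is negative,
so a coefficient `a` gives a flow only if `2a = 0`. Hence the flows inside `B` are exactly the
combinations of its negative circles with coefficients in `torTwo A`
(`IsCanonicalBase.exists_torTwo`).

For every `e ∉ B` there is an integral flow on `B ∪ {e}` with value ±1 at `e` and the circuit
multiplicities (`IsCanonicalBase.exists_isFundamentalFlow`). It is built by cases: an open line, a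
positive circle, or a negative circle joined by a doubled path to an outer-edge or to another
negative circle. On the complement of `B` these flows form a diagonal matrix with entries ±1.
Subtracting from a flow the combination that agrees with it off `B` therefore leaves a flow inside
`B`. This gives both generation and independence, over any `A`.

Over ℝ there is no 2-torsion, so the flows on `B ∪ {e}` form a line. Its common nonzero support is
the unique circuit `C_e`, and the circuit chain of any direction is ± the fundamental flow
(`IsCanonicalBase.coord_circuitChain`). The ranks follow by counting tree edges component by
component. -/

namespace SignedGraph

variable {V E : Type*} (G : SignedGraph V E)

/-! ### Degrees and the existence of circles -/

/-- The endpoints of the edges of `S`. -/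
def verts (S : Set E) : Set V := {v | ∃ e ∈ S, G.IsEndpoint v e}

variable {G}

theorem verts_mono {S T : Set E} (h : S ⊆ T) : G.verts S ⊆ G.verts T :=
  fun _ ⟨e, he, hv⟩ => ⟨e, h he, hv⟩

theorem mem_verts {S : Set E} {e : E} {i : Bool} {v : V} (he : e ∈ S)
    (hv : G.endpt e i = some v) : v ∈ G.verts S := ⟨e, he, i, hv⟩

theorem exists_endpt_of_not_isOuter {e : E} (h : ¬ G.IsOuter e) (i : Bool) :
    ∃ v, G.endpt e i = some v :=
  Option.ne_none_iff_exists'.1 fun h' => h ⟨i, h'⟩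

theorem exists_isEndpoint (G : SignedGraph V E) (e : E) : ∃ v, G.IsEndpoint v e := by
  obtain ⟨i, hi⟩ := G.attached e
  obtain ⟨v, hv⟩ := Option.ne_none_iff_exists'.1 hi
  exact ⟨v, i, hv⟩

theorem degree_eq_zero {S : Set E} {v : V} (h : v ∉ G.verts S) : G.degree S v = 0 := by
  have : {p : E × Bool | p.1 ∈ S ∧ G.endpt p.1 p.2 = some v} = ∅ := by
    ext p
    simp only [Set.mem_ofPred_eq, Set.mem_empty_iff_false, iff_false]
    exact fun hp => h (mem_verts hp.1 hp.2)
  rw [degree, this, Set.ncard_empty]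

section Finite

variable [Fintype E]

open Classical in
theorem degree_eq_card (S : Set E) (v : V) : G.degree S v =
    (Finset.univ.filter fun p : E × Bool => p.1 ∈ S ∧ G.endpt p.1 p.2 = some v).card := by
  rw [degree, ← Set.ncard_coe_finset]
  congr 1
  ext p
  simp

theorem degree_pos {S : Set E} {v : V} (h : v ∈ G.verts S) : 0 < G.degree S v := by
  obtain ⟨e, he, i, hv⟩ := h
  exact (Set.ncard_pos (Set.toFinite _)).2 ⟨(e, i), he, hv⟩

omit [Fintype E] in
theorem degree_eq_one_iff {S : Set E} {v : V} : G.degree S v = 1 ↔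
    ∃ e ∈ S, ∃ i, G.endpt e i = some v ∧
      ∀ e' ∈ S, ∀ j, G.endpt e' j = some v → e' = e ∧ j = i := by
  rw [degree, Set.ncard_eq_one]
  constructor
  · rintro ⟨⟨e, i⟩, h⟩
    have h1 : (e, i) ∈ {p : E × Bool | p.1 ∈ S ∧ G.endpt p.1 p.2 = some v} := by simp [h]
    refine ⟨e, h1.1, i, h1.2, fun e' he' j hj => ?_⟩
    have h2 : (e', j) ∈ {p : E × Bool | p.1 ∈ S ∧ G.endpt p.1 p.2 = some v} := ⟨he', hj⟩
    rw [h] at h2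
    simpa using h2
  · rintro ⟨e, he, i, hi, h⟩
    refine ⟨(e, i), ?_⟩
    ext ⟨e', j⟩
    simp only [Set.mem_ofPred_eq, Set.mem_singleton_iff, Prod.mk.injEq]
    exact ⟨fun h' => h e' h'.1 j h'.2, by rintro ⟨rfl, rfl⟩; exact ⟨he, hi⟩⟩

/-- Handshake count by ends; an outer-edge would contribute only one end. -/
theorem sum_degree [Fintype V] {S : Set E} (hS : ∀ e ∈ S, ¬ G.IsOuter e) :
    ∑ v, G.degree S v = 2 * S.ncard := by
  classical
  simp only [degree_eq_card, Finset.card_filter]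
  rw [Finset.sum_comm]
  have h1 : ∀ p : E × Bool, (∑ v, if p.1 ∈ S ∧ G.endpt p.1 p.2 = some v then 1 else 0) =
      if p.1 ∈ S then 1 else 0 := by
    intro p
    by_cases hp : p.1 ∈ S
    · obtain ⟨u, hu⟩ := exists_endpt_of_not_isOuter (hS _ hp) p.2
      simp [hp, hu]
    · simp [hp]
  rw [Finset.sum_congr rfl fun p _ => h1 p, Fintype.sum_prod_type]
  simp only [Fintype.sum_bool]
  rw [Finset.sum_add_distrib, ← two_mul, ← Finset.card_filter, ← Set.ncard_coe_finset]
  congr 2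
  ext e
  simp

theorem sum_degree_verts [Fintype V] {S : Set E} (hS : ∀ e ∈ S, ¬ G.IsOuter e) :
    ∑ v ∈ (Set.toFinite (G.verts S)).toFinset, G.degree S v = 2 * S.ncard := by
  rw [← sum_degree hS]
  refine Finset.sum_subset (Finset.subset_univ _) fun v _ hv => degree_eq_zero ?_
  simpa using hv

/-- A nonempty edge set without outer-edges that spans no more vertices than it has edges contains
a circle. -/
theorem exists_isCircle_of_ncard_le [Fintype V] {S : Set E} (hne : S.Nonempty)
    (hout : ∀ e ∈ S, ¬ G.IsOuter e) (hcard : (G.verts S).ncard ≤ S.ncard) :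
    ∃ C ⊆ S, G.IsCircle C := by
  classical
  -- A minimal set with at least as many edges as vertices will be the circle: every proper nonempty
  -- subset then spans strictly more vertices than it has edges.
  obtain ⟨C, hCS, hC⟩ := exists_minimal_le_of_wellFoundedLT
    (fun S : Set E => S.Nonempty ∧ (∀ e ∈ S, ¬ G.IsOuter e) ∧ (G.verts S).ncard ≤ S.ncard) S
    ⟨hne, hout, hcard⟩
  obtain ⟨⟨hCne, hCout, hCcard⟩, hmin⟩ := hC
  have key : ∀ D ⊆ C, D ≠ C → D.Nonempty → D.ncard < (G.verts D).ncard := by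
    intro D hD hDC hDne
    by_contra hlt
    exact hDC (hD.antisymm (hmin ⟨hDne, fun e he => hCout e (hD he), not_lt.1 hlt⟩ hD))
  have hvne : 0 < (G.verts C).ncard := by
    obtain ⟨e, he⟩ := hCne
    obtain ⟨v, hv⟩ := G.exists_isEndpoint e
    exact (Set.ncard_pos (Set.toFinite _)).2 ⟨v, e, he, hv⟩
  have hdel : ∀ e ∈ C, (C \ {e}).ncard + 1 = C.ncard := fun e he =>
    Set.ncard_sdiff_singleton_add_one he
  have hcard' : C.ncard ≤ (G.verts C).ncard := by
    by_contra hlt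
    obtain ⟨e, he⟩ := hCne
    have h1 := hdel e he
    have h2 : (C \ {e}).Nonempty := (Set.ncard_pos (Set.toFinite _)).1 (by omega)
    have h3 := key (C \ {e}) Set.sdiff_subset (fun h => (h.ge he).2 rfl) h2
    have h4 := Set.ncard_le_ncard (G.verts_mono (Set.sdiff_subset : C \ {e} ⊆ C))
    omega
  -- Deleting the edge at a vertex of degree one also deletes that vertex, against minimality. If it
  -- is the only edge, there is a single vertex and the edge is a loop, of degree two.
  have hdeg : ∀ v ∈ G.verts C, 2 ≤ G.degree C v := by
    intro v hv
    have h0 := degree_pos hv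
    by_contra hlt
    obtain ⟨e, he, i, hi, huniq⟩ := degree_eq_one_iff.1 (show G.degree C v = 1 by omega)
    have h1 := hdel e he
    have hv' : v ∉ G.verts (C \ {e}) := by
      rintro ⟨e', he', j, hj⟩
      exact he'.2 (huniq e' he'.1 j hj).1
    have h4 : (G.verts (C \ {e})).ncard < (G.verts C).ncard := Set.ncard_lt_ncard
      ⟨G.verts_mono Set.sdiff_subset, fun h => hv' (h hv)⟩
    rcases (C \ {e}).eq_empty_or_nonempty with h2 | h2
    · rw [h2, Set.ncard_empty] at h1
      obtain ⟨u, hu⟩ := exists_endpt_of_not_isOuter (hCout e he) (!i)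
      have h5 : u = v := (Set.ncard_le_one (Set.toFinite _)).1 (by omega) u (mem_verts he hu) v hv
      have := (huniq e he (!i) (h5 ▸ hu)).2
      simp at this
    · have h3 := key (C \ {e}) Set.sdiff_subset (fun h => (h.ge he).2 rfl) h2
      omega
  -- The degrees are at least 2 and sum to twice the number of vertices, so all are equal to 2.
  have hdeg2 : ∀ v ∈ G.verts C, G.degree C v = 2 := by
    have h1 := sum_degree_verts hCout
    have h2 : ∑ v ∈ (Set.toFinite (G.verts C)).toFinset, 2 = 2 * (G.verts C).ncard := by
      rw [Finset.sum_const, smul_eq_mul, mul_comm, Set.ncard_eq_toFinset_card _ (Set.toFinite _)]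
    have h3 : ∑ v ∈ (Set.toFinite (G.verts C)).toFinset, 2 =
        ∑ v ∈ (Set.toFinite (G.verts C)).toFinset, G.degree C v := by
      rw [h1, h2]; omega
    have h4 := (Finset.sum_eq_sum_iff_of_le (fun v hv => hdeg v (by simpa using hv))).1 h3
    exact fun v hv => (h4 v (by simpa using hv)).symm
  refine ⟨C, hCS, hCne, hCout, fun e he v hv => hdeg2 v ⟨e, he, hv⟩, ?_⟩
  intro e he e' he' u v hu hv
  by_contra hreach
  -- If `C` were disconnected, the edges meeting the class of `u` and the remaining edges would have
  -- disjoint vertex sets, each larger than its edge set, so `C` would have more vertices than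
  -- edges.
  let X : Set V := {w | (G.linkGraph C).Reachable u w}
  have hX : ∀ d ∈ C, ∀ x y, G.IsEndpoint x d → G.IsEndpoint y d → x ∈ X → y ∈ X := by
    rintro d hd x y ⟨i, hi⟩ ⟨j, hj⟩ hx
    by_cases hxy : x = y
    · exact hxy ▸ hx
    · refine SimpleGraph.Reachable.trans hx (SimpleGraph.Adj.reachable ⟨hxy, d, hd, i, hi, ?_⟩)
      have : j = !i := by
        cases i <;> cases j <;> simp_all
      exact this ▸ hj
  let D : Set E := {d ∈ C | ∃ x ∈ X, G.IsEndpoint x d}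
  have hD : D ⊆ C := fun d hd => hd.1
  have heD : e ∈ D := ⟨he, u, SimpleGraph.Reachable.refl u, hu⟩
  have he'D : e' ∉ D := by
    rintro ⟨-, x, hx, hxe⟩
    exact hreach (hX e' he' x v hxe hv hx)
  have h1 := key D hD (fun h => he'D (h ▸ he')) ⟨e, heD⟩
  have h2 := key (C \ D) Set.sdiff_subset (fun h => (h.ge he).2 heD) ⟨e', he', he'D⟩
  have h3 : Disjoint (G.verts D) (G.verts (C \ D)) := by
    rw [Set.disjoint_left]
    rintro x ⟨d, ⟨hd, y, hy, hyd⟩, hxd⟩ ⟨d', hd', hxd'⟩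
    exact hd'.2 ⟨hd'.1, x, hX d hd y x hyd hxd hy, hxd'⟩
  have h4 : (G.verts D ∪ G.verts (C \ D)).ncard ≤ (G.verts C).ncard :=
    Set.ncard_le_ncard (Set.union_subset (G.verts_mono hD) (G.verts_mono Set.sdiff_subset))
  rw [Set.ncard_union_eq h3] at h4
  have h5 := Set.ncard_sdiff_add_ncard_of_subset hD
  omega

end Finite

theorem IsCircle.degree_eq {C : Set E} (hC : G.IsCircle C) {v : V} (hv : v ∈ G.verts C) :
    G.degree C v = 2 := by
  obtain ⟨e, he, hv⟩ := hv
  exact hC.regular e he v hv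

theorem IsCircle.reachable {C : Set E} (hC : G.IsCircle C) {u v : V} (hu : u ∈ G.verts C)
    (hv : v ∈ G.verts C) : (G.linkGraph C).Reachable u v := by
  obtain ⟨e, he, hu⟩ := hu
  obtain ⟨e', he', hv⟩ := hv
  exact hC.connected e he e' he' u v hu hv

/-! ### Chains as functions on the edges -/

variable (G) in
/-- The direction of the arrow of the reference arc of `e` at the end `i`. -/
def endSign (e : E) (i : Bool) : ℤ := ((G.refOrientation e).toward i : ℤ)

theorem endSign_true (e : E) : G.endSign e true = 1 := by simp [endSign, refOrientation]

theorem endSign_false (e : E) : G.endSign e false = - (G.sign e : ℤ) := by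
  simp [endSign, refOrientation]

theorem endSign_eq_or (e : E) (i : Bool) : G.endSign e i = 1 ∨ G.endSign e i = -1 := by
  rcases Int.units_eq_one_or ((G.refOrientation e).toward i) with h | h <;> simp [endSign, h]

theorem endSign_mul_self (e : E) (i : Bool) : G.endSign e i * G.endSign e i = 1 := by
  rcases G.endSign_eq_or e i with h | h <;> simp [h]

/-! ### The boundary operator in edge coordinates -/

section Boundary

variable [Fintype E] {A : Type*} [AddCommGroup A]

variable (G) in
/-- The boundary operator in the coordinates given by the reference orientation. -/
noncomputable def bd (A : Type*) [AddCommGroup A] : (E → A) →+ (V → A) where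
  toFun x v := ∑ e, (G.refOrientation e).incidence v • x e
  map_zero' := by ext v; simp
  map_add' c d := by ext v; simp [smul_add, Finset.sum_add_distrib]

-- Summing over ends instead of edges lets a loop contribute its two ends separately, in step with
-- the definition of `degree`.
open Classical in
theorem bd_apply (x : E → A) (v : V) : G.bd A x v =
    ∑ p : E × Bool, if G.endpt p.1 p.2 = some v then G.endSign p.1 p.2 • x p.1 else 0 := by
  rw [Fintype.sum_prod_type]
  refine Finset.sum_congr rfl fun e _ => ?_
  simp only [Arc.incidence, Finset.sum_smul, endSign]
  refine Finset.sum_congr rfl fun i _ => ?_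
  split_ifs <;> simp

theorem bd_eq_zero {x : E → A} {v : V} (h : v ∉ G.verts (Function.support x)) :
    G.bd A x v = 0 := by
  classical
  rw [bd_apply]
  refine Finset.sum_eq_zero fun p _ => ?_
  split_ifs with hp
  · have : x p.1 = 0 := by
      by_contra hx
      exact h (mem_verts hx hp)
    rw [this, smul_zero]
  · rfl

open Classical in
theorem bd_eq_sum_ends {x : E → A} {S : Set E} (hS : Function.support x ⊆ S) (v : V) :
    G.bd A x v = ∑ p ∈ Finset.univ.filter
      (fun p : E × Bool => p.1 ∈ S ∧ G.endpt p.1 p.2 = some v), G.endSign p.1 p.2 • x p.1 := by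
  rw [bd_apply, Finset.sum_filter]
  refine Finset.sum_congr rfl fun p _ => ?_
  by_cases hp : p.1 ∈ S
  · simp [hp]
  · have : x p.1 = 0 := by
      by_contra hx
      exact hp (hS hx)
    simp [hp, this]

open Classical in
theorem bd_single [DecidableEq E] (e : E) (a : A) (v : V) : G.bd A (Pi.single e a) v =
    (if G.endpt e true = some v then G.endSign e true • a else 0) +
      (if G.endpt e false = some v then G.endSign e false • a else 0) := by
  rw [bd_apply, Fintype.sum_prod_type, Finset.sum_eq_single e]
  · simp
  · intro e' _ he'
    simp [he']
  · simp

theorem bd_single_of_ends [DecidableEq E] [DecidableEq V] {e : E} {i : Bool} {u w : V}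
    (hu : G.endpt e i = some u) (hw : G.endpt e (!i) = some w) (a : A) :
    G.bd A (Pi.single e a) =
      Pi.single u (G.endSign e i • a) + Pi.single w (G.endSign e (!i) • a) := by
  ext x
  rw [bd_single, Pi.add_apply, Pi.single_apply, Pi.single_apply]
  cases i
  · simp_all [eq_comm (a := x), add_comm]
  · simp_all [eq_comm (a := x)]

theorem bd_single_of_outer [DecidableEq E] [DecidableEq V] {e : E} {i : Bool} {u : V}
    (hu : G.endpt e i = some u) (hn : G.endpt e (!i) = none) (a : A) :
    G.bd A (Pi.single e a) = Pi.single u (G.endSign e i • a) := by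
  ext x
  rw [bd_single, Pi.single_apply]
  cases i <;> simp_all [eq_comm (a := x)]

omit [Fintype E] in
theorem endSign_smul_eq_zero {e : E} {i : Bool} {a : A} : G.endSign e i • a = 0 ↔ a = 0 := by
  rcases G.endSign_eq_or e i with h | h <;> simp [h]

/-- The support of a nonzero chain without outer-edges whose boundary vanishes except possibly at
one vertex contains a circle. -/
theorem exists_isCircle_of_bd_eq_zero [Fintype V] {x : E → A} (hx : x ≠ 0)
    (hout : ∀ e ∈ Function.support x, ¬ G.IsOuter e) (w : V)
    (hbd : ∀ v, v ≠ w → G.bd A x v = 0) : ∃ C ⊆ Function.support x, G.IsCircle C := by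
  classical
  set S := Function.support x with hS
  -- At a vertex of degree one the boundary is a single term `± x e`, which is nonzero on the
  -- support.
  have hdeg : ∀ v ∈ G.verts S, v ≠ w → 2 ≤ G.degree S v := by
    intro v hv hvw
    have h0 := degree_pos hv
    by_contra hlt
    obtain ⟨e, he, i, hi, huniq⟩ := degree_eq_one_iff.1 (show G.degree S v = 1 by omega)
    have h1 := hbd v hvw
    rw [bd_eq_sum_ends hS.symm.subset, Finset.sum_eq_single (e, i)] at h1
    · exact he (endSign_smul_eq_zero.1 h1)
    · rintro ⟨e', j⟩ hp hne
      simp only [Finset.mem_filter, Finset.mem_univ, true_and] at hp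
      exact absurd (Prod.ext_iff.2 (huniq e' hp.1 j hp.2)) hne
    · intro h
      exact absurd (by simpa using ⟨he, hi⟩) h
  refine exists_isCircle_of_ncard_le (Function.support_nonempty_iff.2 hx) hout ?_
  have h1 := sum_degree_verts hout
  -- The exceptional vertex costs at most one in the degree sum; as that sum is even, the vertex
  -- bound survives.
  have h2 : ∑ v ∈ (Set.toFinite (G.verts S)).toFinset, (2 - if v = w then 1 else 0) ≤
      ∑ v ∈ (Set.toFinite (G.verts S)).toFinset, G.degree S v := by
    refine Finset.sum_le_sum fun v hv => ?_
    have hv : v ∈ G.verts S := by simpa using hv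
    split_ifs with h
    · exact degree_pos hv
    · exact hdeg v hv h
  have h3 : 2 * (G.verts S).ncard ≤
      ∑ v ∈ (Set.toFinite (G.verts S)).toFinset, (2 - if v = w then 1 else 0) + 1 := by
    have h4 : ∑ v ∈ (Set.toFinite (G.verts S)).toFinset, 2 =
        ∑ v ∈ (Set.toFinite (G.verts S)).toFinset, (2 - if v = w then 1 else 0) +
        ∑ v ∈ (Set.toFinite (G.verts S)).toFinset, (if v = w then 1 else 0) := by
      rw [← Finset.sum_add_distrib]
      refine Finset.sum_congr rfl fun v _ => ?_
      split_ifs <;> rfl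
    rw [Finset.sum_const, smul_eq_mul, mul_comm, Finset.sum_ite_eq',
      ← Set.ncard_eq_toFinset_card _ (Set.toFinite _)] at h4
    split_ifs at h4 <;> omega
  omega

/-- The characteristic chain of a circle is a flow modulo 2. -/
theorem IsCircle.bd_indicator_two {C : Set E} (hC : G.IsCircle C) :
    G.bd (ZMod 2) (C.indicator 1) = 0 := by
  classical
  ext v
  rw [bd_eq_sum_ends Set.support_indicator_subset, Pi.zero_apply]
  have h1 : ∀ p ∈ Finset.univ.filter
      (fun p : E × Bool => p.1 ∈ C ∧ G.endpt p.1 p.2 = some v),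
      G.endSign p.1 p.2 • C.indicator (1 : E → ZMod 2) p.1 = 1 := by
    intro p hp
    simp only [Finset.mem_filter, Finset.mem_univ, true_and] at hp
    rw [Set.indicator_of_mem hp.1]
    rcases G.endSign_eq_or p.1 p.2 with h | h <;> rw [h]
    · simp
    · rw [Pi.one_apply]
      decide
  rw [Finset.sum_congr rfl h1, Finset.sum_const, ← degree_eq_card]
  by_cases hv : v ∈ G.verts C
  · rw [hC.degree_eq hv]; decide
  · rw [degree_eq_zero hv]; simp

end Boundary

end SignedGraph

namespace SignedGraph

variable {V E : Type*} {G : SignedGraph V E}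

/-! ### Orientations of circles -/

/-- `c` is the coordinate function of an oriented edge set `S`. -/
def IsUnitOn (S : Set E) (c : E → ℤ) : Prop := (∀ e ∈ S, c e = 1 ∨ c e = -1) ∧ ∀ e ∉ S, c e = 0

theorem IsUnitOn.support_eq {S : Set E} {c : E → ℤ} (hc : IsUnitOn S c) :
    Function.support c = S := by
  ext e
  by_cases he : e ∈ S
  · rcases hc.1 e he with h | h <;> simp [he, h]
  · simp [he, hc.2 e he]

theorem IsUnitOn.abs_eq {S : Set E} {c : E → ℤ} (hc : IsUnitOn S c) {e : E} (he : e ∈ S) :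
    |c e| = 1 := by
  rcases hc.1 e he with h | h <;> simp [h]

variable [Fintype E]

/-- Exactly two ends of `D` lie at each of its vertices, each contributing ±1. -/
theorem IsCircle.bd_eq_or {D : Set E} (hD : G.IsCircle D) {c : E → ℤ} (hc : IsUnitOn D c) (v : V) :
    G.bd ℤ c v = 0 ∨ G.bd ℤ c v = 2 ∨ G.bd ℤ c v = -2 := by
  classical
  by_cases hv : v ∈ G.verts D
  · have h1 := hD.degree_eq hv
    rw [degree_eq_card] at h1
    obtain ⟨p, q, hpq, h2⟩ := Finset.card_eq_two.1 h1
    have h3 : ∀ r ∈ ({p, q} : Finset (E × Bool)), G.endSign r.1 r.2 • c r.1 = 1 ∨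
        G.endSign r.1 r.2 • c r.1 = -1 := by
      intro r hr
      rw [← h2] at hr
      simp only [Finset.mem_filter, Finset.mem_univ, true_and] at hr
      rcases G.endSign_eq_or r.1 r.2 with h | h <;> rcases hc.1 r.1 hr.1 with h' | h' <;>
        simp [h, h']
    rw [bd_eq_sum_ends hc.support_eq.subset, h2, Finset.sum_pair hpq]
    rcases h3 p (by simp) with h | h <;> rcases h3 q (by simp) with h' | h' <;>
      rw [h, h'] <;> decide
  · left
    exact bd_eq_zero (by rwa [hc.support_eq])

open Classical in
/-- Reversing edges along a walk changes the boundary modulo 4 only at the ends of the walk. -/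
theorem exists_isUnitOn_of_walk {D : Set E} {u v : V} (p : (G.linkGraph D).Walk u v) :
    ∀ c : E → ℤ, IsUnitOn D c → ∃ c' : E → ℤ, IsUnitOn D c' ∧ ∀ x,
      G.bd ℤ c' x ≡ G.bd ℤ c x + (if x = u then 2 else 0) + (if x = v then 2 else 0) [ZMOD 4] := by
  induction p with
  | nil =>
    intro c hc
    refine ⟨c, hc, fun x => ?_⟩
    split_ifs
    · rw [Int.modEq_iff_dvd]; exact ⟨1, by ring⟩
    · simp
  | @cons u w v h p ih =>
    intro c hc
    obtain ⟨huw, e, he, i, hu, hw⟩ := h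
    -- Adding `-2 * c e` at `e` reverses this edge. Modulo 4 this adds 2 at both of its ends
    -- whatever the signs, so the contributions at inner vertices of the walk cancel.
    have hc1 : IsUnitOn D (c + Pi.single e (-2 * c e)) := by
      refine ⟨fun d hd => ?_, fun d hd => ?_⟩
      · by_cases hde : d = e
        · subst hde
          rcases hc.1 d hd with h | h <;> simp [h]
        · simpa [hde] using hc.1 d hd
      · have hde : d ≠ e := fun h => hd (h ▸ he)
        simp [hde, hc.2 d hd]
    obtain ⟨c', hc', h'⟩ := ih _ hc1
    refine ⟨c', hc', fun x => (h' x).trans ?_⟩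
    have hmod : ∀ j, G.endSign e j • (-2 * c e) ≡ 2 [ZMOD 4] := by
      intro j
      rcases G.endSign_eq_or e j with h | h <;> rcases hc.1 e he with h'' | h'' <;>
        rw [h, h''] <;> decide
    have hsingle : G.bd ℤ (Pi.single e (-2 * c e)) x ≡
        (if x = u then 2 else 0) + (if x = w then 2 else 0) [ZMOD 4] := by
      have hite : ∀ j y, G.endpt e j = some y →
          (if G.endpt e j = some x then G.endSign e j • (-2 * c e) else 0) ≡
            (if x = y then 2 else 0) [ZMOD 4] := by
        intro j y hy
        by_cases hxy : x = y
        · simpa [hxy, hy] using hmod j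
        · simp [hxy, hy, Ne.symm hxy, Int.ModEq.refl]
      rw [bd_single]
      cases i
      · rw [add_comm]
        exact (hite _ _ hu).add (hite _ _ hw)
      · exact (hite _ _ hu).add (hite _ _ hw)
    rw [map_add, Pi.add_apply]
    have h4 : (if x = w then (2 : ℤ) else 0) + (if x = w then 2 else 0) ≡ 0 [ZMOD 4] := by
      split_ifs <;> decide
    have h5 := ((hsingle.add_left (G.bd ℤ c x)).add_right
      (if x = w then 2 else 0)).add_right (if x = v then 2 else 0)
    refine h5.trans ?_
    have h6 := (h4.add_left (G.bd ℤ c x + (if x = u then 2 else 0))).add_right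
      (if x = v then 2 else 0)
    convert h6 using 1 <;> ring

/-- A circle has an orientation whose boundary is concentrated at any prescribed vertex of it. -/
theorem IsCircle.exists_isUnitOn [Fintype V] {D : Set E} (hD : G.IsCircle D) {w : V}
    (hw : w ∈ G.verts D) : ∃ c : E → ℤ, IsUnitOn D c ∧ ∀ v, v ≠ w → G.bd ℤ c v = 0 := by
  classical
  -- Vertices are repaired one at a time: a boundary ±2 at `y` is pushed along a walk to `w`. The
  -- walk lemma controls boundaries only modulo 4, but this suffices because they lie in `{0, 2,
  -- -2}`.
  have key : ∀ X : Finset V, ∃ c : E → ℤ, IsUnitOn D c ∧ ∀ v ∈ X, v ≠ w → G.bd ℤ c v = 0 := by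
    intro X
    induction X using Finset.induction_on with
    | empty =>
      refine ⟨D.indicator 1, ⟨fun e he => Or.inl ?_, fun e he => ?_⟩, by simp⟩
      · simp [he]
      · simp [he]
    | insert y X hy ih =>
      obtain ⟨c, hc, hX⟩ := ih
      by_cases hyw : y = w
      · refine ⟨c, hc, fun v hv hvw => ?_⟩
        rcases Finset.mem_insert.1 hv with h | h
        · exact absurd (h.trans hyw) hvw
        · exact hX v h hvw
      by_cases hy0 : G.bd ℤ c y = 0
      · refine ⟨c, hc, fun v hv hvw => ?_⟩
        rcases Finset.mem_insert.1 hv with h | h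
        · exact h ▸ hy0
        · exact hX v h hvw
      have hyD : y ∈ G.verts D := by
        by_contra hyD
        exact hy0 (bd_eq_zero (by rwa [hc.support_eq]))
      obtain ⟨p⟩ := hD.reachable hyD hw
      obtain ⟨c', hc', h⟩ := exists_isUnitOn_of_walk p c hc
      refine ⟨c', hc', fun v hv hvw => ?_⟩
      have hv' := h v
      rw [if_neg hvw, add_zero] at hv'
      have h0 : G.bd ℤ c' v ≡ 0 [ZMOD 4] := by
        refine hv'.trans ?_
        by_cases hvy : v = y
        · subst hvy
          rcases (hD.bd_eq_or hc v).resolve_left hy0 with h' | h' <;> simp [h']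
        · rcases Finset.mem_insert.1 hv with h | h
          · exact absurd h hvy
          · rw [hX v h hvw, if_neg hvy]
            decide
      rcases hD.bd_eq_or hc' v with h' | h' | h'
      · exact h'
      · rw [h'] at h0; exact absurd h0 (by decide)
      · rw [h'] at h0; exact absurd h0 (by decide)
  obtain ⟨c, hc, h⟩ := key Finset.univ
  exact ⟨c, hc, fun v => h v (Finset.mem_univ v)⟩

/-- The two end signs of an edge are `1` and minus its sign: a positive edge cancels in the total
and a negative one counts twice. -/
theorem sum_bd [Fintype V] {c : E → ℤ} (hc : ∀ e, c e ≠ 0 → ¬ G.IsOuter e) :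
    ∑ v, G.bd ℤ c v = ∑ e, c e * (1 - (G.sign e : ℤ)) := by
  classical
  simp only [bd_apply]
  rw [Finset.sum_comm, Fintype.sum_prod_type]
  refine Finset.sum_congr rfl fun e _ => ?_
  by_cases he : c e = 0
  · simp [he]
  · obtain ⟨u, hu⟩ := exists_endpt_of_not_isOuter (hc e he) true
    obtain ⟨v, hv⟩ := exists_endpt_of_not_isOuter (hc e he) false
    simp [hu, hv, endSign_true, endSign_false]
    ring

-- Modulo 4 both sides are twice the number of negative edges, since 2 and -2 agree.
omit [Fintype E] in
theorem sum_mul_one_sub_modEq (s : Finset E) (c : E → ℤ) (hc : ∀ e ∈ s, c e = 1 ∨ c e = -1)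
    (σ : E → ℤˣ) :
    ∑ e ∈ s, c e * (1 - (σ e : ℤ)) ≡ 1 - ((∏ e ∈ s, σ e : ℤˣ) : ℤ) [ZMOD 4] := by
  classical
  induction s using Finset.induction_on with
  | empty => simp
  | insert e s he ih =>
    rw [Finset.sum_insert he, Finset.prod_insert he]
    refine ((ih fun d hd => hc d (Finset.mem_insert_of_mem hd)).add_left _).trans ?_
    rcases hc e (Finset.mem_insert_self e s) with h | h <;>
      rcases Int.units_eq_one_or (σ e) with h' | h' <;>
      rcases Int.units_eq_one_or (∏ e ∈ s, σ e) with h'' | h'' <;>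
      rw [h, h', h''] <;> decide

/-- A boundary concentrated at `w` equals the total boundary, which modulo 4 depends only on the
parity of the negative edges. -/
theorem IsCircle.bd_modEq [Fintype V] {D : Set E} (hD : G.IsCircle D) {c : E → ℤ}
    (hc : IsUnitOn D c) {w : V} (hw : ∀ v, v ≠ w → G.bd ℤ c v = 0) :
    G.bd ℤ c w ≡ 1 - (G.signOf D : ℤ) [ZMOD 4] := by
  classical
  have h1 : G.bd ℤ c w = ∑ v, G.bd ℤ c v :=
    (Finset.sum_eq_single w (fun v _ hv => hw v hv) (by simp)).symm
  have h2 : G.signOf D = ∏ e ∈ D.toFinset, G.sign e := by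
    rw [signOf, finprod_mem_eq_toFinset_prod]
  rw [h1, sum_bd, h2]
  · rw [← Finset.sum_subset (Finset.subset_univ D.toFinset)]
    · exact sum_mul_one_sub_modEq _ _ (fun e he => hc.1 e (by simpa using he)) _
    · intro e _ he
      rw [hc.2 e (by simpa using he), zero_mul]
  · intro e he
    refine hD.no_outer e ?_
    by_contra h
    exact he (hc.2 e h)

theorem IsCircle.exists_isUnitOn_flow [Fintype V] {D : Set E} (hD : G.IsCircle D)
    (hs : G.signOf D = 1) : ∃ c : E → ℤ, IsUnitOn D c ∧ G.bd ℤ c = 0 := by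
  obtain ⟨e, he⟩ := hD.nonempty
  obtain ⟨w, hw⟩ := G.exists_isEndpoint e
  obtain ⟨c, hc, h⟩ := hD.exists_isUnitOn ⟨e, he, hw⟩
  refine ⟨c, hc, funext fun v => ?_⟩
  by_cases hv : v = w
  · subst hv
    have h1 := hD.bd_modEq hc h
    rw [hs] at h1
    rcases hD.bd_eq_or hc v with h' | h' | h'
    · exact h'
    · rw [h'] at h1; exact absurd h1 (by decide)
    · rw [h'] at h1; exact absurd h1 (by decide)
  · exact h v hv

theorem IsNegativeCircle.exists_isUnitOn [Fintype V] [DecidableEq V] {D : Set E}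
    (hD : G.IsNegativeCircle D) {w : V} (hw : w ∈ G.verts D) :
    ∃ c : E → ℤ, IsUnitOn D c ∧ ∃ s : ℤˣ, G.bd ℤ c = Pi.single w (2 * (s : ℤ)) := by
  obtain ⟨c, hc, h⟩ := hD.1.exists_isUnitOn hw
  have h1 := hD.1.bd_modEq hc h
  rw [hD.2] at h1
  have h2 : ∃ s : ℤˣ, G.bd ℤ c w = 2 * (s : ℤ) := by
    rcases hD.1.bd_eq_or hc w with h' | h' | h'
    · rw [h'] at h1; exact absurd h1 (by decide)
    · exact ⟨1, h'⟩
    · exact ⟨-1, by simp [h']⟩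
  obtain ⟨s, hs⟩ := h2
  refine ⟨c, hc, s, funext fun v => ?_⟩
  by_cases hv : v = w
  · subst hv; simpa using hs
  · simp [hv, h v hv]

/-! ### Chains along paths -/

/-- A path carries a chain with values in `{0, 1, -1}` and boundary concentrated at its ends. -/
theorem exists_chain_of_isPath [DecidableEq V] [DecidableEq E] {T : Set E} {u v : V}
    (p : (G.linkGraph T).Walk u v) (hp : p.IsPath) :
    ∃ q : E → ℤ, (∀ e, q e = 0 ∨ q e = 1 ∨ q e = -1) ∧
      (∀ e, q e ≠ 0 → e ∈ T ∧ ∃ i x y, x ≠ y ∧ G.endpt e i = some x ∧ G.endpt e (!i) = some y ∧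
        x ∈ p.support ∧ y ∈ p.support) ∧
      ∃ s : ℤˣ, G.bd ℤ q = Pi.single u 1 + Pi.single v (s : ℤ) := by
  induction p with
  | nil =>
    -- For the trivial path the two ends coincide, and the sign -1 makes them cancel.
    refine ⟨0, by simp, by simp, -1, ?_⟩
    rw [map_zero, ← Pi.single_add]
    simp
  | @cons u w v h p ih =>
    rw [SimpleGraph.Walk.cons_isPath_iff] at hp
    obtain ⟨q, hq, hqT, s, hs⟩ := ih hp.1
    have hadj := h
    obtain ⟨huw, e, he, i, hu, hw⟩ := hadj
    -- Otherwise both ends of `e`, and so `u`, would lie on the rest of the path.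
    have hqe : q e = 0 := by
      by_contra hne
      obtain ⟨-, j, x, y, -, hx, hy, hxp, hyp⟩ := hqT e hne
      have : u = x ∨ u = y := by
        cases i <;> cases j <;> simp_all
      rcases this with rfl | rfl
      · exact hp.2 hxp
      · exact hp.2 hyp
    set k : ℤ := G.endSign e i * G.endSign e (!i) with hk
    have hk1 : k = 1 ∨ k = -1 := by
      rcases G.endSign_eq_or e i with h | h <;> rcases G.endSign_eq_or e (!i) with h' | h' <;>
        simp [hk, h, h']
    -- The new edge has boundary 1 at `u` and `k` at `w`; since `q` has boundary 1 at `w`,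
    -- subtracting `k • q` cancels the contribution there.
    refine ⟨Pi.single e (G.endSign e i) - k • q, fun d => ?_, fun d hd => ?_, ?_⟩
    · by_cases hde : d = e
      · subst hde
        simpa [hqe] using Or.inr (G.endSign_eq_or d i)
      · rcases hk1 with h | h <;> rcases hq d with h' | h' | h' <;> simp [hde, h, h']
    · by_cases hde : d = e
      · subst hde
        exact ⟨he, i, u, w, huw, hu, hw, by simp, by simp⟩
      · have hqd : q d ≠ 0 := by
          intro h
          simp [hde, h] at hd
        obtain ⟨hT, j, x, y, hxy, hx, hy, hxp, hyp⟩ := hqT d hqd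
        exact ⟨hT, j, x, y, hxy, hx, hy, by simp [hxp], by simp [hyp]⟩
    · have h1 : G.bd ℤ (Pi.single e (G.endSign e i)) = Pi.single u 1 + Pi.single w k := by
        rw [bd_single_of_ends hu hw, smul_eq_mul, smul_eq_mul, endSign_mul_self, hk, mul_comm]
      have h2 : ∃ s' : ℤˣ, (s' : ℤ) = -(k * s) := by
        rcases hk1 with h | h
        · exact ⟨-s, by simp [h]⟩
        · exact ⟨s, by simp [h]⟩
      obtain ⟨s', hs'⟩ := h2
      refine ⟨s', ?_⟩
      rw [map_sub, map_zsmul, hs, h1, hs']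
      ext x
      simp only [Pi.sub_apply, Pi.add_apply, Pi.smul_apply, Pi.single_apply, smul_eq_mul]
      split_ifs <;> ring

omit [Fintype E] in
/-- In a graph where some vertex of `X` reaches some vertex of `Y`, there is a path from `X` to `Y`
that meets `X` and `Y` only in its ends. -/
theorem exists_isPath_between {H : SimpleGraph V} {X Y : Set V} {x y : V} (hx : x ∈ X)
    (hy : y ∈ Y) (h : H.Reachable x y) :
    ∃ u ∈ X, ∃ v ∈ Y, ∃ p : H.Walk u v, p.IsPath ∧ (∀ z ∈ p.support, z ∈ X → z = u) ∧
      ∀ z ∈ p.support, z ∈ Y → z = v := by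
  classical
  -- A walk of least length among all walks from `X` to `Y` works: another visit to `X` or `Y` would
  -- permit a shorter one.
  have hex : ∃ n : ℕ, ∃ u ∈ X, ∃ v ∈ Y, ∃ p : H.Walk u v, p.length = n := by
    obtain ⟨p⟩ := h
    exact ⟨_, x, hx, y, hy, p, rfl⟩
  obtain ⟨u, hu, v, hv, p, hp⟩ := Nat.find_spec hex
  have hmin : ∀ u' ∈ X, ∀ v' ∈ Y, ∀ p' : H.Walk u' v', p.length ≤ p'.length := by
    intro u' hu' v' hv' p'
    rw [hp]
    exact Nat.find_min' hex ⟨u', hu', v', hv', p', rfl⟩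
  refine ⟨u, hu, v, hv, p, ?_, fun z hz hzX => ?_, fun z hz hzY => ?_⟩
  · have h1 := hmin u hu v hv p.bypass
    exact SimpleGraph.Walk.bypass_eq_self_of_length_le_length_bypass p h1 ▸ p.bypass_isPath
  · have h1 := hmin z hzX v hv (p.dropUntil z hz)
    have h2 := congrArg SimpleGraph.Walk.length (p.take_spec hz)
    rw [SimpleGraph.Walk.length_append] at h2
    exact (SimpleGraph.Walk.eq_of_length_eq_zero (p := p.takeUntil z hz) (by omega)).symm
  · have h1 := hmin u hu z hzY (p.takeUntil z hz)
    have h2 := congrArg SimpleGraph.Walk.length (p.take_spec hz)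
    rw [SimpleGraph.Walk.length_append] at h2
    exact SimpleGraph.Walk.eq_of_length_eq_zero (p := p.dropUntil z hz) (by omega)

end SignedGraph

namespace SignedGraph

variable {V E : Type*} {G : SignedGraph V E}

/-! ### Components -/

theorem linkGraph_mono {S T : Set E} (h : S ⊆ T) : G.linkGraph S ≤ G.linkGraph T := by
  rintro u v ⟨huv, e, he, i, hu, hv⟩
  exact ⟨huv, e, h he, i, hu, hv⟩

theorem IsEndpoint.reachable {e : E} {u v : V} (hu : G.IsEndpoint u e) (hv : G.IsEndpoint v e) :
    (G.linkGraph Set.univ).Reachable u v := by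
  obtain ⟨i, hu⟩ := hu
  obtain ⟨j, hv⟩ := hv
  by_cases huv : u = v
  · exact huv ▸ SimpleGraph.Reachable.refl u
  · refine SimpleGraph.Adj.reachable ⟨huv, e, trivial, i, hu, ?_⟩
    have : j = !i := by
      cases i <;> cases j <;> simp_all
    exact this ▸ hv

theorem mem_edgesOf_iff {K : G.Component} {e : E} {v : V} (hv : G.IsEndpoint v e) :
    e ∈ G.edgesOf K ↔ v ∈ K.supp := by
  refine ⟨fun ⟨u, hu, hue⟩ => ?_, fun h => ⟨v, h, hv⟩⟩
  rw [SimpleGraph.ConnectedComponent.mem_supp_iff] at hu ⊢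
  rw [← hu, SimpleGraph.ConnectedComponent.eq]
  exact hv.reachable hue

variable (G) in
/-- The component of an edge. -/
noncomputable def edgeComponent (e : E) : G.Component :=
  (G.linkGraph Set.univ).connectedComponentMk (G.exists_isEndpoint e).choose

theorem edgeComponent_eq_iff {K : G.Component} {e : E} :
    G.edgeComponent e = K ↔ e ∈ G.edgesOf K := by
  rw [mem_edgesOf_iff (G.exists_isEndpoint e).choose_spec,
    SimpleGraph.ConnectedComponent.mem_supp_iff, edgeComponent]

theorem mem_edgesOf_edgeComponent (e : E) : e ∈ G.edgesOf (G.edgeComponent e) :=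
  edgeComponent_eq_iff.1 rfl

theorem verts_subset_supp {K : G.Component} {S : Set E} (hS : S ⊆ G.edgesOf K) :
    G.verts S ⊆ K.supp := by
  rintro v ⟨e, he, hv⟩
  exact (mem_edgesOf_iff hv).1 (hS he)

theorem IsCircle.subset_edgesOf {D : Set E} (hD : G.IsCircle D) {e : E} (he : e ∈ D)
    {K : G.Component} (hK : e ∈ G.edgesOf K) : D ⊆ G.edgesOf K := by
  intro d hd
  obtain ⟨u, hu⟩ := G.exists_isEndpoint e
  obtain ⟨v, hv⟩ := G.exists_isEndpoint d
  rw [mem_edgesOf_iff hu, SimpleGraph.ConnectedComponent.mem_supp_iff] at hK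
  rw [mem_edgesOf_iff hv, SimpleGraph.ConnectedComponent.mem_supp_iff, ← hK,
    SimpleGraph.ConnectedComponent.eq]
  exact (hD.connected d hd e he v u hv hu).mono (linkGraph_mono (Set.subset_univ D))

/-- All edges at a vertex belong to its component, so restriction leaves the boundary unchanged on
`K` and makes it zero elsewhere. -/
theorem bd_indicator_edgesOf [Fintype E] {A : Type*} [AddCommGroup A] {x : E → A}
    (hx : G.bd A x = 0) (K : G.Component) : G.bd A ((G.edgesOf K).indicator x) = 0 := by
  classical
  ext v
  by_cases hv : v ∈ K.supp
  · rw [← hx, bd_apply, bd_apply]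
    refine Finset.sum_congr rfl fun p _ => ?_
    by_cases hp : G.endpt p.1 p.2 = some v
    · rw [Set.indicator_of_mem ((mem_edgesOf_iff ⟨p.2, hp⟩).2 hv)]
    · simp [hp]
  · refine bd_eq_zero fun ⟨e, he, hve⟩ => hv ((mem_edgesOf_iff hve).1 ?_)
    by_contra h
    exact he (Set.indicator_of_notMem h x)

/-! ### Spanning trees -/

/-- The uniqueness principle behind the later arguments: two chains with boundaries equal off one
vertex and equal values off the tree coincide. It is used over `A` and over `ZMod 2`. -/
theorem IsSpanningTree.eq_zero [Fintype V] [Fintype E] {K : G.Component} {T : Set E}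
    (hT : G.IsSpanningTree K T) {A : Type*} [AddCommGroup A] {x : E → A}
    (hx : Function.support x ⊆ T) (w : V) (hbd : ∀ v, v ≠ w → G.bd A x v = 0) : x = 0 := by
  by_contra hne
  obtain ⟨C, hC, hcirc⟩ := exists_isCircle_of_bd_eq_zero hne (fun e he => hT.no_outer e (hx he))
    w hbd
  exact hT.acyclic C (hC.trans hx) hcirc

/-- Too many edges would force a circle. Conversely, each vertex other than a root `r` is sent to
the first edge of a shortest path to `r`, and this map is injective. -/
theorem IsSpanningTree.ncard_add_one [Fintype V] [Fintype E] {K : G.Component} {T : Set E}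
    (hT : G.IsSpanningTree K T) : T.ncard + 1 = K.supp.ncard := by
  obtain ⟨r, hr⟩ := K.nonempty_supp
  have hpos : 0 < K.supp.ncard := (Set.ncard_pos (Set.toFinite _)).2 ⟨r, hr⟩
  apply le_antisymm
  · rcases T.eq_empty_or_nonempty with h | h
    · rw [h, Set.ncard_empty]
      exact hpos
    · have h1 : T.ncard < (G.verts T).ncard := by
        by_contra hlt
        obtain ⟨C, hC, hcirc⟩ := exists_isCircle_of_ncard_le h hT.no_outer (not_lt.1 hlt)
        exact hT.acyclic C hC hcirc
      have h2 := Set.ncard_le_ncard (verts_subset_supp hT.subset)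
      omega
  · have key : ∀ v : V, v ∈ K.supp \ {r} → ∃ e : E, e ∈ T ∧ ∃ i u, G.endpt e i = some v ∧
        G.endpt e (!i) = some u ∧ (G.linkGraph T).dist u r < (G.linkGraph T).dist v r := by
      rintro v ⟨hv, hvr⟩
      obtain ⟨p, hp⟩ := (hT.connected v hv r hr).exists_walk_length_eq_dist
      cases p with
      | nil => exact absurd rfl hvr
      | @cons _ u _ h p =>
        obtain ⟨-, e, he, i, hv, hu⟩ := id h
        refine ⟨e, he, i, u, hv, hu, ?_⟩
        have h1 := SimpleGraph.dist_le p
        rw [SimpleGraph.Walk.length_cons] at hp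
        omega
    have h1 : (K.supp \ {r}).ncard ≤ T.ncard := by
      rcases (K.supp \ {r}).eq_empty_or_nonempty with h0 | ⟨v₀, hv₀⟩
      · simp [h0]
      have : Nonempty E := ⟨(key v₀ hv₀).choose⟩
      have : Nonempty V := ⟨r⟩
      choose! g hgT i u hv hu hd using key
      refine Set.ncard_le_ncard_of_injOn g hgT fun x hx y hy hxy => ?_
      by_cases hi : i x = i y
      · have h1 := hv x hx
        rw [hxy, hi, hv y hy] at h1
        exact (Option.some.inj h1).symm
      -- An edge chosen from its two opposite ends would make each of them closer to `r` than the
      -- other.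
      · have hi' : i y = !(i x) := by
          revert hi
          cases i x <;> cases i y <;> simp
        have h1 := hu x hx
        rw [hxy, ← hi', hv y hy] at h1
        have h2 := hu y hy
        rw [hi', Bool.not_not, ← hxy, hv x hx] at h2
        have h3 := hd x hx
        have h4 := hd y hy
        rw [← Option.some.inj h1] at h3
        rw [← Option.some.inj h2] at h4
        omega
    have h2 := Set.ncard_sdiff_singleton_add_one hr
    omega

/-- Adding an edge that is no outer-edge to a spanning tree creates a circle. -/
theorem IsSpanningTree.exists_isCircle [Fintype V] [Fintype E] {K : G.Component} {T : Set E}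
    (hT : G.IsSpanningTree K T) {e : E} (heK : e ∈ G.edgesOf K) (hout : ¬ G.IsOuter e)
    (he : e ∉ T) : ∃ D ⊆ insert e T, e ∈ D ∧ G.IsCircle D := by
  have h1 : insert e T ⊆ G.edgesOf K := Set.insert_subset heK hT.subset
  have h2 := Set.ncard_le_ncard (verts_subset_supp h1)
  have h3 := hT.ncard_add_one
  have h4 := Set.ncard_insert_of_notMem he
  obtain ⟨D, hD, hcirc⟩ := exists_isCircle_of_ncard_le (Set.insert_nonempty e T)
    (fun d hd => by
      rcases hd with rfl | hd
      · exact hout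
      · exact hT.no_outer d hd) (by omega : (G.verts (insert e T)).ncard ≤ _)
  refine ⟨D, hD, ?_, hcirc⟩
  by_contra heD
  exact hT.acyclic D (fun d hd => (hD hd).resolve_left fun h => heD (h ▸ hd)) hcirc

theorem IsSpanningTree.mem_of_isCircle {K : G.Component} {T : Set E}
    (hT : G.IsSpanningTree K T) {e : E} {D : Set E} (hD : D ⊆ insert e T) (hcirc : G.IsCircle D) :
    e ∈ D := by
  by_contra heD
  exact hT.acyclic D (fun d hd => (hD hd).resolve_left fun h => heD (h ▸ hd)) hcirc

/-- Modulo 2, the circles in a spanning tree with two further edges are combinations of the two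
fundamental circles. -/
theorem IsSpanningTree.indicator_eq [Fintype V] [Fintype E] {K : G.Component} {T : Set E}
    (hT : G.IsSpanningTree K T) {e b : E} (hebT : e ∉ insert b T) (hbT : b ∉ T)
    {C D F : Set E} (hC : G.IsCircle C) (hD : G.IsCircle D) (hF : G.IsCircle F)
    (hDT : D ⊆ insert e T) (hFT : F ⊆ insert b T) (hCT : C ⊆ insert e (insert b T)) :
    C.indicator (1 : E → ZMod 2) = C.indicator (1 : E → ZMod 2) e • D.indicator 1 +
      C.indicator (1 : E → ZMod 2) b • F.indicator 1 := by
  obtain ⟨r, -⟩ := K.nonempty_supp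
  have hbD : b ∉ D := fun h => by
    rcases hDT h with h | h
    · exact hebT (Or.inl h.symm)
    · exact hbT h
  have heF : e ∉ F := fun h => hebT (hFT h)
  have heD := hT.mem_of_isCircle hDT hD
  have hbF := hT.mem_of_isCircle hFT hF
  rw [← sub_eq_zero]
  refine hT.eq_zero (fun t ht => ?_) r fun v _ => ?_
  · by_contra htT
    apply ht
    by_cases hte : t = e
    · subst hte
      simp [heD, heF]
    by_cases htb : t = b
    · subst htb
      simp [hbD, hbF]
    have htC : t ∉ C := fun h => by
      rcases hCT h with h | h | h
      exacts [hte h, htb h, htT h]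
    have htD : t ∉ D := fun h => (hDT h).elim hte htT
    have htF : t ∉ F := fun h => (hFT h).elim htb htT
    simp [htC, htD, htF]
  · have hsmul : ∀ (a : ZMod 2) (x : E → ZMod 2), G.bd (ZMod 2) x = 0 →
        G.bd (ZMod 2) (a • x) = 0 := by
      intro a x hx
      -- `bd` is only additive, so a scalar of `ZMod 2` is replaced by a natural multiple.
      have : a • x = a.val • x := by
        ext t
        simp
      rw [this, map_nsmul, hx, smul_zero]
    rw [map_sub, map_add, hsmul _ _ hD.bd_indicator_two, hsmul _ _ hF.bd_indicator_two,
      hC.bd_indicator_two]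
    simp

/-- Both circles contain `e`, so the difference of their indicators modulo 2 is a flow on the tree,
hence zero. -/
theorem IsSpanningTree.circle_unique [Fintype V] [Fintype E] {K : G.Component} {T : Set E}
    (hT : G.IsSpanningTree K T) {e : E} {C D : Set E} (hC : G.IsCircle C)
    (hD : G.IsCircle D) (hCT : C ⊆ insert e T) (hDT : D ⊆ insert e T) : C = D := by
  obtain ⟨r, -⟩ := K.nonempty_supp
  have heC := hT.mem_of_isCircle hCT hC
  have heD := hT.mem_of_isCircle hDT hD
  have h : C.indicator (1 : E → ZMod 2) - D.indicator 1 = 0 := by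
    refine hT.eq_zero (fun t ht => ?_) r fun v _ => ?_
    · by_contra htT
      apply ht
      by_cases hte : t = e
      · subst hte
        simp [heC, heD]
      have htC : t ∉ C := fun h => (hCT h).elim hte htT
      have htD : t ∉ D := fun h => (hDT h).elim hte htT
      simp [htC, htD]
    · rw [map_sub, hC.bd_indicator_two, hD.bd_indicator_two]
      simp
  ext t
  have ht := congrFun h t
  by_cases h1 : t ∈ C <;> by_cases h2 : t ∈ D <;> simp_all

/-! ### The size of a canonical base -/

theorem IsCanonicalBase.ncard_inter_edgesOf [Fintype V] [Fintype E] {B : Set E}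
    (hB : G.IsCanonicalBase B) (K : G.Component) [Decidable (G.IsBalanced K)] :
    (B ∩ G.edgesOf K).ncard + (if G.IsBalanced K then 1 else 0) = K.supp.ncard := by
  obtain ⟨T, hT, ⟨hK, h⟩ | ⟨hK, e, he, hout, h⟩ | ⟨hK, hK', e, he, ⟨C, hC, hneg⟩, h⟩⟩ := hB K
  · rw [h, if_pos hK, hT.ncard_add_one]
  · rw [h, if_neg fun h => hK h.1, Set.ncard_insert_of_notMem fun h => hT.no_outer e h hout,
      add_zero, hT.ncard_add_one]
  · have heT : e ∉ T := fun h => hT.acyclic C (by rwa [Set.insert_eq_of_mem h] at hC) hneg.1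
    rw [h, if_neg hK', Set.ncard_insert_of_notMem heT, add_zero, hT.ncard_add_one]

theorem IsCanonicalBase.ncard_add_numBalanced [Fintype V] [Fintype E] {B : Set E}
    (hB : G.IsCanonicalBase B) : B.ncard + G.numBalanced = Nat.card V := by
  classical
  have hfin : Fintype G.Component := Fintype.ofFinite _
  have h1 : Nat.card V = ∑ K : G.Component, K.supp.ncard := by
    rw [Nat.card_eq_fintype_card, ← Finset.card_univ,
      Finset.card_eq_sum_card_fiberwise (t := Finset.univ)
        (f := (G.linkGraph Set.univ).connectedComponentMk) (fun _ _ => by simp)]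
    refine Finset.sum_congr rfl fun K _ => ?_
    rw [← Set.ncard_coe_finset]
    congr 1
    ext v
    simp [SimpleGraph.ConnectedComponent.mem_supp_iff]
  have h2 : B.ncard = ∑ K : G.Component, (B ∩ G.edgesOf K).ncard := by
    rw [Set.ncard_eq_toFinset_card', Finset.card_eq_sum_card_fiberwise (t := Finset.univ)
        (f := G.edgeComponent) (fun _ _ => by simp)]
    refine Finset.sum_congr rfl fun K _ => ?_
    rw [← Set.ncard_coe_finset]
    congr 1
    ext v
    simp [edgeComponent_eq_iff]
  have h3 : G.numBalanced = ∑ K : G.Component, if G.IsBalanced K then 1 else 0 := by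
    rw [numBalanced, Nat.card_eq_fintype_card, Fintype.card_subtype, Finset.card_filter]
  rw [h1, h2, h3, ← Finset.sum_add_distrib]
  exact Finset.sum_congr rfl fun K _ => hB.ncard_inter_edgesOf K

/-- Since `B.ncard` and the number of balanced components add up to the number of vertices, the rank
is `B.ncard` and neither natural subtraction truncates. -/
theorem IsCanonicalBase.cycleRank_eq [Fintype V] [Fintype E] {B : Set E}
    (hB : G.IsCanonicalBase B) : G.cycleRank = Nat.card {e : E // e ∉ B} := by
  have h1 := hB.ncard_add_numBalanced
  have h2 := Set.ncard_add_ncard_compl B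
  have h3 : Nat.card {e : E // e ∉ B} = Bᶜ.ncard := rfl
  rw [cycleRank, rank, h3]
  omega

end SignedGraph

namespace SignedGraph

variable {V E : Type*} {G : SignedGraph V E} [Fintype E]

/-! ### Fundamental flows -/

open Classical in
variable (G) in
/-- `f` is an integral flow with value `±1` at `e` that is supported in `B ∪ {e}` and has the
multiplicities prescribed for a circuit. -/
structure IsFundamentalFlow (B : Set E) (e : E) (f : E → ℤ) : Prop where
  bd_eq : G.bd ℤ f = 0
  support_subset : Function.support f ⊆ insert e B
  abs_self : |f e| = 1
  abs_eq : ∀ t ∈ Function.support f, |f t| = if G.IsDouble (Function.support f) t then 2 else 1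

/-- A positive circle is itself a circuit; all its edges lie on a circle, so none is double. -/
theorem IsCircle.exists_isFundamentalFlow [Fintype V] {B D : Set E} {e : E} (hD : G.IsCircle D)
    (hs : G.signOf D = 1) (he : e ∈ D) (hDB : D ⊆ insert e B) :
    ∃ f, G.IsFundamentalFlow B e f := by
  obtain ⟨c, hc, hbd⟩ := hD.exists_isUnitOn_flow hs
  refine ⟨c, hbd, hc.support_eq.symm ▸ hDB, hc.abs_eq he, fun t ht => ?_⟩
  rw [hc.support_eq] at ht ⊢
  rw [if_neg fun h => h.2.2 D subset_rfl hD ht, hc.abs_eq ht]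

/-- The two outer-edges and the tree path between them form an open line. Its support contains no
circle, so no edge is double. -/
theorem exists_isFundamentalFlow_of_isOuter [Fintype V] {K : G.Component} {T B : Set E}
    (hT : G.IsSpanningTree K T) (hTB : T ⊆ B) {e o : E} (heK : e ∈ G.edgesOf K)
    (hoK : o ∈ G.edgesOf K) (he : G.IsOuter e) (ho : G.IsOuter o) (heB : e ∉ B) (hoB : o ∈ B) :
    ∃ f, G.IsFundamentalFlow B e f := by
  classical
  have hend : ∀ d ∈ G.edgesOf K, G.IsOuter d →
      ∃ u ∈ K.supp, ∃ i, G.endpt d i = some u ∧ G.endpt d (!i) = none := by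
    rintro d hd ⟨i, hi⟩
    obtain ⟨v, j, hv⟩ := G.exists_isEndpoint d
    refine ⟨v, (mem_edgesOf_iff ⟨j, hv⟩).1 hd, j, hv, ?_⟩
    have : i = !j := by
      cases i <;> cases j <;> simp_all
    exact this ▸ hi
  obtain ⟨u, hu, i, hi, hin⟩ := hend e heK he
  obtain ⟨v, hv, j, hj, hjn⟩ := hend o hoK ho
  have heo : e ≠ o := fun h => heB (h ▸ hoB)
  have heT : e ∉ T := fun h => heB (hTB h)
  have hoT : o ∉ T := fun h => hT.no_outer o h ho
  obtain ⟨p, hp⟩ := (hT.connected u hu v hv).exists_isPath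
  obtain ⟨q, hq, hqT, s, hs⟩ := exists_chain_of_isPath p hp
  have hq0 : ∀ d ∉ T, q d = 0 := fun d hd => by
    by_contra h
    exact hd (hqT d h).1
  -- The coefficient at `e` gives boundary 1 at `u` and that at `o` gives `s` at `v`; together they
  -- cancel the boundary of `q`.
  set f : E → ℤ := Pi.single e (G.endSign e i) - q + Pi.single o (G.endSign o j * s) with hf
  have hfe : |f e| = 1 := by
    rcases G.endSign_eq_or e i with h | h <;> simp [hf, heo, hq0 e heT, h]
  have hfo : |f o| = 1 := by
    rcases G.endSign_eq_or o j with h | h <;> rcases Int.units_eq_one_or s with h' | h' <;>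
      simp [hf, heo.symm, hq0 o hoT, h, h']
  have hft : ∀ t, t ≠ e → t ≠ o → f t = - q t := fun t hte hto => by
    simp [hf, hte, hto]
  have hsub : Function.support f ⊆ insert e (insert o T) := by
    intro t ht
    by_contra h
    simp only [Set.mem_insert_iff, not_or] at h
    exact ht (by rw [hft t h.1 h.2.1, hq0 t h.2.2, neg_zero])
  refine ⟨f, ?_, fun t ht => ?_, hfe, fun t ht => ?_⟩
  · rw [hf, map_add, map_sub, bd_single_of_outer hi hin, bd_single_of_outer hj hjn, hs,
      smul_eq_mul, endSign_mul_self, smul_eq_mul, ← mul_assoc, endSign_mul_self, one_mul]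
    simp
  · rcases hsub ht with h | h | h
    · exact Or.inl h
    · exact Or.inr (h ▸ hoB)
    · exact Or.inr (hTB h)
  · rw [if_neg]
    · by_cases hte : t = e
      · exact hte ▸ hfe
      by_cases hto : t = o
      · exact hto ▸ hfo
      have h := hft t hte hto
      rw [h]
      rcases hq t with h' | h' | h'
      · exact absurd (by rw [h, h', neg_zero]) ht
      · simp [h']
      · simp [h']
    · rintro ⟨-, ⟨D, hD, hcirc, -⟩, -⟩
      refine hT.acyclic D (fun d hd => ?_) hcirc
      rcases hsub (hD hd) with rfl | rfl | h
      · exact absurd he (hcirc.no_outer _ hd)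
      · exact absurd ho (hcirc.no_outer _ hd)
      · exact h

/-- Joining a negative circle by a path in a spanning tree to a family of chains whose boundary
can be concentrated at any vertex of `Y`. -/
theorem IsNegativeCircle.exists_joined_flow [Fintype V] [DecidableEq V] {K : G.Component}
    {T D Z : Set E} (hT : G.IsSpanningTree K T) (hD : G.IsNegativeCircle D)
    (hDK : D ⊆ G.edgesOf K) {Y : Set V} (hYK : Y ⊆ K.supp) (hY : Y.Nonempty) {m : ℤ}
    (hZY : ∀ e ∈ T, e ∈ Z → ∀ v, G.IsEndpoint v e → v ∈ Y) (hDZ : Disjoint D Z)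
    (hz : ∀ y ∈ Y, ∃ z : E → ℤ, Function.support z = Z ∧ (∀ t ∈ Z, |z t| = m) ∧
      ∃ s : ℤˣ, G.bd ℤ z = Pi.single y (2 * (s : ℤ))) :
    ∃ (f : E → ℤ) (Q : Set E), G.bd ℤ f = 0 ∧ Q ⊆ T ∧ Disjoint Q D ∧ Disjoint Q Z ∧
      Function.support f = D ∪ Q ∪ Z ∧ (∀ t ∈ D, |f t| = 1) ∧ (∀ t ∈ Q, |f t| = 2) ∧
      ∀ t ∈ Z, |f t| = m := by
  classical
  obtain ⟨x, hx⟩ : (G.verts D).Nonempty := by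
    obtain ⟨e, he⟩ := hD.1.nonempty
    obtain ⟨v, hv⟩ := G.exists_isEndpoint e
    exact ⟨v, e, he, hv⟩
  obtain ⟨y, hy⟩ := hY
  obtain ⟨u, hu, v, hv, p, hp, hpu, hpv⟩ := exists_isPath_between hx hy
    (hT.connected x (verts_subset_supp hDK hx) y (hYK hy))
  obtain ⟨q, hq, hqT, s₂, hs₂⟩ := exists_chain_of_isPath p hp
  obtain ⟨c, hc, s₁, hs₁⟩ := hD.exists_isUnitOn hu
  obtain ⟨z, hzZ, hzm, s₃, hs₃⟩ := hz v hv
  -- An edge used by `q` has two distinct ends on the path, whereas the path meets the circle in `u`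
  -- only. The same argument applies to `Z` and `v`.
  have hQD : Disjoint (Function.support q) D := by
    rw [Set.disjoint_left]
    intro t ht htD
    obtain ⟨-, i, a, b, hab, ha, hb, hap, hbp⟩ := hqT t ht
    exact hab ((hpu a hap (mem_verts htD ha)).trans (hpu b hbp (mem_verts htD hb)).symm)
  have hQZ : Disjoint (Function.support q) Z := by
    rw [Set.disjoint_left]
    intro t ht htZ
    obtain ⟨htT, i, a, b, hab, ha, hb, hap, hbp⟩ := hqT t ht
    exact hab ((hpv a hap (hZY t htT htZ a ⟨i, ha⟩)).trans
      (hpv b hbp (hZY t htT htZ b ⟨!i, hb⟩)).symm)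
  have hc0 : ∀ t ∉ D, c t = 0 := hc.2
  have hz0 : ∀ t ∉ Z, z t = 0 := fun t ht => by
    by_contra h
    exact ht (hzZ ▸ h)
  -- The circle leaves `2 * s₁` at `u`, so the path must carry weight 2. This moves the excess to
  -- `v` as `-2 * s₁ * s₂`, where the sign in front of `z` cancels it.
  set f : E → ℤ := c - (2 * (s₁ : ℤ)) • q + ((s₁ * s₂ * s₃ : ℤˣ) : ℤ) • z with hf
  have hfD : ∀ t ∈ D, f t = c t := by
    intro t ht
    have h1 : q t = 0 := Function.notMem_support.1 (Set.disjoint_right.1 hQD ht)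
    simp [hf, h1, hz0 t (Set.disjoint_left.1 hDZ ht)]
  have hfQ : ∀ t ∈ Function.support q, f t = - (2 * (s₁ : ℤ)) * q t := by
    intro t ht
    simp [hf, hc0 t (Set.disjoint_left.1 hQD ht), hz0 t (Set.disjoint_left.1 hQZ ht)]
  have hfZ : ∀ t ∈ Z, f t = ((s₁ * s₂ * s₃ : ℤˣ) : ℤ) * z t := by
    intro t ht
    have h1 : q t = 0 := Function.notMem_support.1 (Set.disjoint_right.1 hQZ ht)
    simp [hf, h1, hc0 t (Set.disjoint_right.1 hDZ ht)]
  have habsD : ∀ t ∈ D, |f t| = 1 := fun t ht => by rw [hfD t ht, hc.abs_eq ht]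
  have habsQ : ∀ t ∈ Function.support q, |f t| = 2 := by
    intro t ht
    rw [hfQ t ht]
    rcases (hq t).resolve_left ht with h | h <;> rcases Int.units_eq_one_or s₁ with h' | h' <;>
      simp [h, h']
  have habsZ : ∀ t ∈ Z, |f t| = |z t| := by
    intro t ht
    rw [hfZ t ht]
    rcases Int.units_eq_one_or (s₁ * s₂ * s₃) with h | h <;> simp [h]
  refine ⟨f, Function.support q, ?_, fun t ht => (hqT t ht).1, hQD, hQZ, ?_, habsD, habsQ,
    fun t ht => (habsZ t ht).trans (hzm t ht)⟩
  · rw [hf, map_add, map_sub, map_zsmul, map_zsmul, hs₁, hs₂, hs₃]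
    ext w
    simp only [Pi.sub_apply, Pi.add_apply, Pi.smul_apply, Pi.single_apply, smul_eq_mul,
      Pi.zero_apply]
    rcases Int.units_eq_one_or s₁ with h | h <;> rcases Int.units_eq_one_or s₂ with h' | h' <;>
      rcases Int.units_eq_one_or s₃ with h'' | h'' <;> simp only [h, h', h''] <;>
      split_ifs <;> simp
  · ext t
    by_cases htD : t ∈ D
    · have : f t ≠ 0 := fun h => by simpa [h] using habsD t htD
      simp [this, htD]
    by_cases htQ : t ∈ Function.support q
    · have : f t ≠ 0 := fun h => by simpa [h] using habsQ t htQ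
      simp only [Function.mem_support, Set.mem_union]
      tauto
    by_cases htZ : t ∈ Z
    · have hzt : z t ≠ 0 := hzZ.ge htZ
      have : f t ≠ 0 := fun h => hzt (by simpa [h] using (habsZ t htZ).symm)
      simp [this, htZ]
    · have hqt : q t = 0 := Function.notMem_support.1 htQ
      simp [hf, htD, hqt, htZ, hc0 t htD, hz0 t htZ]

/-- A negative circle with a half-line: here `Z` is the outer-edge `o` with value 2. The circle `D`
is the only one in the support, so all other edges are double. -/
theorem IsNegativeCircle.exists_isFundamentalFlow_of_isOuter [Fintype V] {K : G.Component}
    {T B D : Set E} (hT : G.IsSpanningTree K T) (hTB : T ⊆ B) (hD : G.IsNegativeCircle D)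
    {e o : E} (heK : e ∈ G.edgesOf K) (hoK : o ∈ G.edgesOf K) (he : e ∈ D)
    (hDT : D ⊆ insert e T) (ho : G.IsOuter o) (hoB : o ∈ B) :
    ∃ f, G.IsFundamentalFlow B e f := by
  classical
  have hoT : o ∉ T := fun h => hT.no_outer o h ho
  have hoD : o ∉ D := fun h => hD.1.no_outer o h ho
  obtain ⟨y, j, hy⟩ := G.exists_isEndpoint o
  have hyn : G.endpt o (!j) = none := by
    obtain ⟨i, hi⟩ := ho
    have : i = !j := by
      cases i <;> cases j <;> simp_all
    exact this ▸ hi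
  have hz : ∀ x ∈ ({y} : Set V), ∃ z : E → ℤ, Function.support z = {o} ∧
      (∀ t ∈ ({o} : Set E), |z t| = 2) ∧ ∃ s : ℤˣ, G.bd ℤ z = Pi.single x (2 * (s : ℤ)) := by
    rintro x rfl
    refine ⟨Pi.single o 2, Pi.support_single_of_ne (by norm_num), ?_,
      (G.refOrientation o).toward j, ?_⟩
    · rintro t rfl
      simp
    · rw [bd_single_of_outer hy hyn, smul_eq_mul, mul_comm]
      rfl
  obtain ⟨f, Q, hbd, hQT, hQD, hQo, hsupp, hfD, hfQ, hfo⟩ := hD.exists_joined_flow hT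
    (hD.1.subset_edgesOf he heK) (Y := {y})
    (Set.singleton_subset_iff.2 ((mem_edgesOf_iff ⟨j, hy⟩).1 hoK)) (Set.singleton_nonempty y)
    (fun t htT hto => absurd (hto ▸ htT) hoT) (Set.disjoint_singleton_right.2 hoD) hz
  have hdouble : ∀ t ∈ Function.support f, t ∉ D → G.IsDouble (Function.support f) t := by
    intro t ht htD
    refine ⟨ht, ⟨D, ?_, hD⟩, fun C hC hcirc htC => htD ?_⟩
    · rw [hsupp]
      exact Set.subset_union_left.trans Set.subset_union_left
    · rw [← hT.circle_unique hcirc hD.1 (fun d hd => ?_) hDT]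
      · exact htC
      · have h1 := hC hd
        rw [hsupp] at h1
        rcases h1 with (h1 | h1) | h1
        · exact hDT h1
        · exact Or.inr (hQT h1)
        · exact absurd ho (h1 ▸ hcirc.no_outer d hd)
  refine ⟨f, hbd, ?_, hfD e he, fun t ht => ?_⟩
  · rw [hsupp]
    rintro t ((h | h) | h)
    · exact Set.insert_subset_insert hTB (hDT h)
    · exact Or.inr (hTB (hQT h))
    · exact Or.inr (h ▸ hoB)
  · by_cases htD : t ∈ D
    · have hDf : D ⊆ Function.support f := by
        rw [hsupp]
        exact Set.subset_union_left.trans Set.subset_union_left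
      rw [if_neg fun h => h.2.2 D hDf hD.1 htD, hfD t htD]
    · rw [if_pos (hdouble t ht htD)]
      rw [hsupp] at ht
      rcases ht with (h | h) | h
      · exact absurd h htD
      · exact hfQ t h
      · exact hfo t h

/-- Here `Z` is the second negative circle. Only the edge sets are disjoint: with a common vertex
the connecting path has length zero. -/
theorem IsNegativeCircle.exists_isFundamentalFlow_of_disjoint [Fintype V] {K : G.Component}
    {T B D F : Set E} (hT : G.IsSpanningTree K T) (hD : G.IsNegativeCircle D)
    (hF : G.IsNegativeCircle F) {e b : E} (heK : e ∈ G.edgesOf K) (hbK : b ∈ G.edgesOf K)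
    (hDT : D ⊆ insert e T) (hFT : F ⊆ insert b T) (heB : e ∉ B) (hbT : b ∉ T)
    (hTB : insert b T ⊆ B) (hDF : Disjoint D F) :
    ∃ f, G.IsFundamentalFlow B e f := by
  classical
  have he := hT.mem_of_isCircle hDT hD.1
  have hb := hT.mem_of_isCircle hFT hF.1
  obtain ⟨f, Q, hbd, hQT, hQD, hQF, hsupp, hfD, hfQ, hfF⟩ := hD.exists_joined_flow hT
    (hD.1.subset_edgesOf he heK) (Y := G.verts F) (Z := F) (m := 1)
    (verts_subset_supp (hF.1.subset_edgesOf hb hbK))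
    (by
      obtain ⟨v, hv⟩ := G.exists_isEndpoint b
      exact ⟨v, b, hb, hv⟩)
    (fun t _ htF v hv => ⟨t, htF, hv⟩) hDF
    (fun y hy => by
      obtain ⟨c, hc, s, hs⟩ := hF.exists_isUnitOn hy
      exact ⟨c, hc.support_eq, fun t ht => hc.abs_eq ht, s, hs⟩)
  have hDf : D ⊆ Function.support f := by
    rw [hsupp]
    exact Set.subset_union_left.trans Set.subset_union_left
  have hFf : F ⊆ Function.support f := by
    rw [hsupp]
    exact Set.subset_union_right
  have hsub : Function.support f ⊆ insert e (insert b T) := by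
    rw [hsupp]
    rintro t ((h | h) | h)
    · exact Set.insert_subset_insert (Set.subset_insert b T) (hDT h)
    · exact Or.inr (Or.inr (hQT h))
    · exact Or.inr (hFT h)
  refine ⟨f, hbd, hsub.trans (Set.insert_subset_insert hTB), hfD e he, fun t ht => ?_⟩
  by_cases htD : t ∈ D
  · rw [if_neg fun h => h.2.2 D hDf hD.1 htD, hfD t htD]
  by_cases htF : t ∈ F
  · rw [if_neg fun h => h.2.2 F hFf hF.1 htF, hfF t htF]
  -- Every circle in the support is a combination of `D` and `F` modulo 2, so it avoids the edges
  -- outside both.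
  have hdouble : G.IsDouble (Function.support f) t := by
    refine ⟨ht, ⟨D, hDf, hD⟩, fun C hC hcirc htC => ?_⟩
    have h1 := congrFun (hT.indicator_eq (fun h => heB (hTB h)) hbT hcirc hD.1 hF.1 hDT hFT
      (hC.trans hsub)) t
    simp [htC, htD, htF] at h1
  rw [if_pos hdouble]
  rw [hsupp] at ht
  rcases ht with (h | h) | h
  · exact absurd h htD
  · exact hfQ t h
  · exact absurd h htF

theorem signOf_eq_prod (S : Set E) [DecidablePred (· ∈ S)] :
    G.signOf S = ∏ e, if e ∈ S then G.sign e else 1 := by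
  rw [signOf, finprod_mem_def, finprod_eq_prod_of_fintype]
  refine Finset.prod_congr rfl fun e _ => ?_
  by_cases he : e ∈ S <;> simp [he]

/-- Two negative fundamental circles that share an edge give rise to a positive circle. -/
theorem IsSpanningTree.exists_positive_circle [Fintype V] {K : G.Component}
    {T D F : Set E} (hT : G.IsSpanningTree K T) (hD : G.IsNegativeCircle D)
    (hF : G.IsNegativeCircle F) {e b : E}
    (hDT : D ⊆ insert e T) (hFT : F ⊆ insert b T) (hebT : e ∉ insert b T) (hbT : b ∉ T)
    (hDF : ¬ Disjoint D F) :
    ∃ C ⊆ insert e (insert b T), e ∈ C ∧ G.IsCircle C ∧ G.signOf C = 1 := by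
  classical
  have he := hT.mem_of_isCircle hDT hD.1
  have heF : e ∉ F := fun h => hebT (hFT h)
  obtain ⟨g, hgD, hgF⟩ := Set.not_disjoint_iff.1 hDF
  obtain ⟨r, -⟩ := K.nonempty_supp
  -- The sum modulo 2 is the symmetric difference of `D` and `F`; it is a flow and is nonzero at
  -- `e`, so its support contains a circle.
  set x : E → ZMod 2 := D.indicator 1 + F.indicator 1 with hx
  have hxne : x ≠ 0 := fun h => by
    have := congrFun h e
    simp [hx, he, heF] at this
  have hxsub : Function.support x ⊆ D ∪ F := by
    intro t ht
    by_contra h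
    simp only [Set.mem_union, not_or] at h
    exact ht (by simp [hx, h.1, h.2])
  obtain ⟨C, hC, hcirc⟩ := exists_isCircle_of_bd_eq_zero (G := G) hxne
    (fun d hd => (hxsub hd).elim (hD.1.no_outer d) (hF.1.no_outer d)) r
    (fun v _ => by rw [hx, map_add, hD.1.bd_indicator_two, hF.1.bd_indicator_two]; simp)
  have hCT : C ⊆ insert e (insert b T) := by
    intro t ht
    rcases hxsub (hC ht) with h | h
    · exact Set.insert_subset_insert (Set.subset_insert b T) (hDT h)
    · exact Or.inr (hFT h)
  have hind := hT.indicator_eq hebT hbT hcirc hD.1 hF.1 hDT hFT hCT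
  have hgC : g ∉ C := fun h => hC h (by simp only [hx, Pi.add_apply, hgD, hgF,
    Set.indicator_of_mem, Pi.one_apply]; decide)
  -- The shared edge `g` is not in `C`, so the coefficients of `D` and `F` agree; being nonempty,
  -- `C` is the whole symmetric difference, and its sign is the product of the two signs.
  have heb : e ∈ C ↔ b ∈ C := by
    have h1 := congrFun hind g
    by_cases h : e ∈ C <;> by_cases h' : b ∈ C <;> simp_all
  have heC : e ∈ C := by
    by_contra h
    obtain ⟨t, ht⟩ := hcirc.nonempty
    have h1 := congrFun hind t
    simp [h, heb.not.1 h, ht] at h1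
  refine ⟨C, hCT, heC, hcirc, ?_⟩
  have hmem : ∀ t, t ∈ C ↔ (t ∈ D ∧ t ∉ F) ∨ (t ∉ D ∧ t ∈ F) := by
    intro t
    have h1 := congrFun hind t
    have h2 : (1 : ZMod 2) + 1 = 0 := by decide
    by_cases h3 : t ∈ C <;> by_cases h4 : t ∈ D <;> by_cases h5 : t ∈ F <;>
      simp [heC, heb.1 heC, h3, h4, h5, h2] at h1 ⊢
  have hprod : G.signOf C = G.signOf D * G.signOf F := by
    rw [signOf_eq_prod, signOf_eq_prod, signOf_eq_prod, ← Finset.prod_mul_distrib]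
    refine Finset.prod_congr rfl fun t _ => ?_
    have h2 : G.sign t * G.sign t = 1 := Int.units_mul_self _
    by_cases h4 : t ∈ D <;> by_cases h5 : t ∈ F <;> simp [hmem t, h4, h5, h2]
  rw [hprod, hD.2, hF.2]
  rfl

/-- Every edge outside a canonical base has a fundamental flow. -/
theorem IsCanonicalBase.exists_isFundamentalFlow [Fintype V] {B : Set E}
    (hB : G.IsCanonicalBase B) {e : E} (he : e ∉ B) : ∃ f, G.IsFundamentalFlow B e f := by
  set K := G.edgeComponent e
  have heK : e ∈ G.edgesOf K := mem_edgesOf_edgeComponent e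
  obtain ⟨T, hT, hK⟩ := hB K
  have hTB : T ⊆ B := by
    rcases hK with ⟨-, h⟩ | ⟨-, o, -, -, h⟩ | ⟨-, -, b, -, -, h⟩
    · rw [← h]; exact Set.inter_subset_left
    · exact (Set.subset_insert o T).trans (h ▸ Set.inter_subset_left)
    · exact (Set.subset_insert b T).trans (h ▸ Set.inter_subset_left)
  by_cases hout : G.IsOuter e
  · rcases hK with ⟨hK, -⟩ | ⟨-, o, ho, hoo, h⟩ | ⟨hK, -⟩
    · exact absurd hout (hK.1 e heK)
    · exact exists_isFundamentalFlow_of_isOuter hT hTB heK ho hout hoo he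
        (h.ge (Set.mem_insert o T)).1
    · exact absurd hout (hK e heK)
  · obtain ⟨D, hDT, heD, hD⟩ := hT.exists_isCircle heK hout fun h => he (hTB h)
    rcases Int.units_eq_one_or (G.signOf D) with hs | hs
    · exact hD.exists_isFundamentalFlow hs heD (hDT.trans (Set.insert_subset_insert hTB))
    rcases hK with ⟨hK, -⟩ | ⟨-, o, ho, hoo, h⟩ | ⟨-, -, b, hbK, ⟨F, hFT, hF⟩, h⟩
    · exact absurd (hs.symm.trans (hK.2 D (hD.subset_edgesOf heD heK) hD)) (by decide)
    · exact IsNegativeCircle.exists_isFundamentalFlow_of_isOuter hT hTB ⟨hD, hs⟩ heK ho heD hDT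
        hoo (h.ge (Set.mem_insert o T)).1
    · have hbTB : insert b T ⊆ B := h ▸ Set.inter_subset_left
      have hbT : b ∉ T := fun h' =>
        hT.acyclic F (by rwa [Set.insert_eq_of_mem h'] at hFT) hF.1
      -- If the two negative circles overlap in an edge, the positive circle in their union replaces
      -- the joined pair.
      by_cases hDF : Disjoint D F
      · exact IsNegativeCircle.exists_isFundamentalFlow_of_disjoint hT ⟨hD, hs⟩ hF heK hbK hDT
          hFT he hbT hbTB hDF
      · obtain ⟨C, hC, heC, hcirc, hsC⟩ := hT.exists_positive_circle ⟨hD, hs⟩ hF hDT hFT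
          (fun h' => he (hbTB h')) hbT hDF
        exact hcirc.exists_isFundamentalFlow hsC heC (hC.trans (Set.insert_subset_insert hbTB))

end SignedGraph

namespace SignedGraph

variable {V E : Type*} {G : SignedGraph V E}

/-! ### Flows supported in a canonical base -/

/-- Every component contains at most one negative circle of a canonical base. -/
theorem IsCanonicalBase.circle_unique [Fintype V] [Fintype E] {B : Set E}
    (hB : G.IsCanonicalBase B) {C D : Set E} (hC : G.IsNegativeCircle C)
    (hD : G.IsNegativeCircle D) (hCB : C ⊆ B) (hDB : D ⊆ B) {e d : E} (he : e ∈ C) (hd : d ∈ D)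
    {K : G.Component} (heK : e ∈ G.edgesOf K) (hdK : d ∈ G.edgesOf K) : C = D := by
  have hCK := Set.subset_inter hCB (hC.1.subset_edgesOf he heK)
  have hDK := Set.subset_inter hDB (hD.1.subset_edgesOf hd hdK)
  obtain ⟨T, hT, ⟨-, h⟩ | ⟨-, o, -, -, h⟩ | ⟨-, -, b, -, -, h⟩⟩ := hB K
  · exact absurd hC.1 (hT.acyclic C (h ▸ hCK))
  · rw [h] at hCK hDK
    exact hT.circle_unique hC.1 hD.1 hCK hDK
  · rw [h] at hCK hDK
    exact hT.circle_unique hC.1 hD.1 hCK hDK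

/-- A component that contains a negative circle of a canonical base is compact and unbalanced. -/
theorem IsCanonicalBase.isCompact_of_circle {B : Set E}
    (hB : G.IsCanonicalBase B) {C : Set E} (hC : G.IsNegativeCircle C) (hCB : C ⊆ B) {e : E}
    (he : e ∈ C) {K : G.Component} (heK : e ∈ G.edgesOf K) :
    G.IsCompact K ∧ ¬ G.IsBalanced K := by
  have hCK' := hC.1.subset_edgesOf he heK
  have hCK := Set.subset_inter hCB hCK'
  obtain ⟨T, hT, ⟨-, h⟩ | ⟨-, o, -, ho, h⟩ | ⟨hK, hK', -⟩⟩ := hB K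
  · exact absurd hC.1 (hT.acyclic C (h ▸ hCK))
  · rw [h] at hCK
    exact absurd ho (hC.1.no_outer o (hT.mem_of_isCircle hCK hC.1))
  · exact ⟨hK, hK'⟩

theorem IsCanonicalBase.exists_circle {B : Set E} (hB : G.IsCanonicalBase B) {K : G.Component}
    (hK : G.IsCompact K) (hK' : ¬ G.IsBalanced K) :
    ∃ C ⊆ B ∩ G.edgesOf K, G.IsNegativeCircle C := by
  obtain ⟨T, hT, ⟨h, -⟩ | ⟨h, -⟩ | ⟨-, -, b, -, ⟨C, hC, hneg⟩, h⟩⟩ := hB K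
  · exact absurd h hK'
  · exact absurd hK h
  · exact ⟨C, h ▸ hC, hneg⟩

variable (G) in
/-- The negative circles contained in `B`. -/
abbrev BaseCircle (B : Set E) := {ρ : Set E // G.IsNegativeCircle ρ ∧ ρ ⊆ B}

/-- Sending a circle to its component is a bijection onto the compact unbalanced components. -/
theorem IsCanonicalBase.card_baseCircle [Fintype V] [Fintype E] {B : Set E}
    (hB : G.IsCanonicalBase B) : Nat.card (G.BaseCircle B) = G.numCompactUnbalanced := by
  refine Nat.card_congr (Equiv.ofBijective (fun ρ => ⟨G.edgeComponent ρ.2.1.1.nonempty.some,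
    hB.isCompact_of_circle ρ.2.1 ρ.2.2 ρ.2.1.1.nonempty.some_mem (mem_edgesOf_edgeComponent _)⟩)
    ⟨fun ρ τ h => ?_, fun K => ?_⟩)
  · have h1 := Subtype.ext_iff.1 h
    exact Subtype.ext (hB.circle_unique ρ.2.1 τ.2.1 ρ.2.2 τ.2.2 ρ.2.1.1.nonempty.some_mem
      τ.2.1.1.nonempty.some_mem (edgeComponent_eq_iff.1 h1) (mem_edgesOf_edgeComponent _))
  · obtain ⟨C, hC, hneg⟩ := hB.exists_circle K.2.1 K.2.2
    refine ⟨⟨C, hneg, hC.trans Set.inter_subset_left⟩, Subtype.ext ?_⟩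
    exact edgeComponent_eq_iff.2 (hC hneg.1.nonempty.some_mem).2

theorem mem_torTwo {A : Type*} [AddCommGroup A] {a : A} : a ∈ torTwo A ↔ 2 • a = 0 := Iff.rfl

theorem neg_eq_of_mem_torTwo {A : Type*} [AddCommGroup A] {a : A} (ha : a ∈ torTwo A) :
    -a = a := by
  rw [mem_torTwo, two_nsmul] at ha
  exact neg_eq_of_add_eq_zero_left ha

variable [Fintype E] {A : Type*} [AddCommGroup A]

theorem bd_smul_const (c : E → ℤ) (a : A) (v : V) :
    G.bd A (fun e => c e • a) v = G.bd ℤ c v • a := by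
  simp only [bd, AddMonoidHom.coe_mk, ZeroHom.coe_mk, Finset.sum_smul, smul_smul, smul_eq_mul]

/-- Every boundary coefficient of a circle is 0 or ±2, which kills 2-torsion whatever the sign of
the circle. -/
theorem IsCircle.bd_indicator_torTwo {D : Set E} (hD : G.IsCircle D) {a : A}
    (ha : a ∈ torTwo A) : G.bd A (D.indicator fun _ => a) = 0 := by
  have hc : IsUnitOn D (D.indicator 1) :=
    ⟨fun e he => Or.inl (by simp [he]), fun e he => by simp [he]⟩
  have h1 : (D.indicator fun _ => a) = fun e => D.indicator (1 : E → ℤ) e • a := by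
    ext e
    by_cases he : e ∈ D <;> simp [he]
  have h2 : (2 : ℤ) • a = 0 := by
    rw [mem_torTwo] at ha
    exact_mod_cast ha
  ext v
  rw [h1, bd_smul_const]
  rcases hD.bd_eq_or hc v with h | h | h <;> rw [h]
  · simp
  · exact h2
  · rw [neg_smul, h2, neg_zero, Pi.zero_apply]

/-- In every component, a flow supported in a canonical base is zero or a 2-torsion multiple of the
negative circle. -/
theorem IsCanonicalBase.indicator_edgesOf [Fintype V] {B : Set E}
    (hB : G.IsCanonicalBase B) {x : E → A} (hx : G.bd A x = 0) (hxB : Function.support x ⊆ B)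
    (K : G.Component) : (G.edgesOf K).indicator x = 0 ∨
      ∃ C ⊆ B ∩ G.edgesOf K, G.IsNegativeCircle C ∧ ∃ a ∈ torTwo A,
        (G.edgesOf K).indicator x = C.indicator fun _ => a := by
  classical
  set y := (G.edgesOf K).indicator x with hy
  have hbd : G.bd A y = 0 := bd_indicator_edgesOf hx K
  have hysub : Function.support y ⊆ B ∩ G.edgesOf K := by
    intro e he
    have heK : e ∈ G.edgesOf K := by
      by_contra h
      exact he (Set.indicator_of_notMem h x)
    refine ⟨hxB fun h => he ?_, heK⟩
    rw [hy, Set.indicator_of_mem heK, h]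
  obtain ⟨r, -⟩ := K.nonempty_supp
  obtain ⟨T, hT, ⟨hK, h⟩ | ⟨hK, o, hoK, ho, h⟩ | ⟨hK, hK', b, hbK, ⟨C, hC, hneg⟩, h⟩⟩ := hB K
  · left
    exact hT.eq_zero (h ▸ hysub) r fun v _ => by rw [hbd, Pi.zero_apply]
  · left
    rw [h] at hysub
    obtain ⟨u, j, hu⟩ := G.exists_isEndpoint o
    have hun : G.endpt o (!j) = none := by
      obtain ⟨i, hi⟩ := ho
      have : i = !j := by
        cases i <;> cases j <;> simp_all
      exact this ▸ hi
    -- Without its value at `o`, the chain lives on the tree with boundary only at `u`, so it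
    -- vanishes; the boundary at `u` then forces `y o = 0`.
    have hbd' : G.bd A (y - Pi.single o (y o)) = - Pi.single u (G.endSign o j • y o) := by
      rw [map_sub, hbd, bd_single_of_outer hu hun, zero_sub]
    have hzero : y - Pi.single o (y o) = 0 := by
      refine hT.eq_zero (fun t ht => ?_) u fun v hv => ?_
      · by_cases hto : t = o
        · subst hto
          simp at ht
        · exact (hysub (fun h' => ht (by simp [hto, h']) : y t ≠ 0)).resolve_left hto
      · rw [hbd']
        simp [hv]
    have hyo : y o = 0 := by
      have h1 := congrFun hbd' u
      rw [hzero, map_zero] at h1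
      simpa [endSign_smul_eq_zero] using h1
    rw [hyo, Pi.single_zero, sub_zero] at hzero
    exact hzero
  · right
    have hbC := hT.mem_of_isCircle hC hneg.1
    obtain ⟨w, hw⟩ := G.exists_isEndpoint b
    obtain ⟨c, hc, s, hs⟩ := hneg.exists_isUnitOn ⟨b, hbC, hw⟩
    -- As `c b = ±1`, the chain `c • a` agrees with `y` at `b`; the difference lies on the tree with
    -- boundary only at `w`, so it is zero.
    set a := c b • y b with ha
    have hbd' : ∀ v, G.bd A (y - fun e => c e • a) v =
        - ((Pi.single w (2 * (s : ℤ)) : V → ℤ) v • a) := by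
      intro v
      rw [map_sub, hbd, zero_sub, Pi.neg_apply, bd_smul_const, hs]
    have hzero : (y - fun e => c e • a) = 0 := by
      refine hT.eq_zero (fun t ht => ?_) w fun v hv => ?_
      · by_cases htb : t = b
        · subst htb
          have h1 : c t * c t = 1 := by
            rcases hc.1 t hbC with h | h <;> simp [h]
          exact absurd (by simp [ha, smul_smul, h1]) ht
        · by_contra htT
          have h1 : y t = 0 := by
            by_contra hne
            exact (h ▸ hysub hne : t ∈ insert b T).elim htb htT
          have h2 : c t = 0 := hc.2 t fun h' => (hC h').elim htb htT
          exact ht (by simp [h1, h2])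
      · rw [hbd']
        simp [hv]
    -- What remains of the boundary at `w` says `± 2 a = 0`.
    have hator : a ∈ torTwo A := by
      have h1 := hbd' w
      rw [hzero, map_zero, Pi.single_eq_same, Pi.zero_apply, eq_comm, neg_eq_zero] at h1
      rw [mem_torTwo, two_nsmul, ← two_zsmul]
      rcases Int.units_eq_one_or s with h' | h' <;> simpa [h'] using h1
    refine ⟨C, h ▸ hC, hneg, a, hator, ?_⟩
    ext t
    have h1 := congrFun hzero t
    rw [Pi.sub_apply, Pi.zero_apply, sub_eq_zero] at h1
    rw [h1]
    by_cases ht : t ∈ C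
    · rw [Set.indicator_of_mem ht]
      rcases hc.1 t ht with h' | h' <;> rw [h']
      · simp
      · rw [neg_smul, one_smul, neg_eq_of_mem_torTwo hator]
    · rw [Set.indicator_of_notMem ht, hc.2 t ht, zero_smul]

theorem IsCanonicalBase.eq_zero_of_support_subset [Fintype V] {B : Set E}
    (hB : G.IsCanonicalBase B) {x : E → ℝ} (hx : G.bd ℝ x = 0) (hxB : Function.support x ⊆ B) :
    x = 0 := by
  ext e
  have heK := G.mem_edgesOf_edgeComponent e
  have h1 : x e = (G.edgesOf (G.edgeComponent e)).indicator x e := by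
    rw [Set.indicator_of_mem heK]
  rw [h1]
  rcases hB.indicator_edgesOf hx hxB (G.edgeComponent e) with h | ⟨C, -, -, a, ha, h⟩
  · rw [h]
  · have ha0 : a = 0 := by simpa [mem_torTwo] using ha
    rw [h, ha0]
    simp

/-- The descriptions of the single components glue, since each component contains at most one
negative circle of `B`. -/
theorem IsCanonicalBase.exists_torTwo [Fintype V] {B : Set E}
    (hB : G.IsCanonicalBase B) {x : E → A} (hx : G.bd A x = 0) (hxB : Function.support x ⊆ B)
    [Fintype (G.BaseCircle B)] : ∃ a : G.BaseCircle B → torTwo A,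
      x = ∑ ρ : G.BaseCircle B, ρ.1.indicator fun _ => (a ρ : A) := by
  have key : ∀ ρ : G.BaseCircle B, ∃ a : torTwo A, ∀ e ∈ ρ.1, x e = a := by
    intro ρ
    obtain ⟨d, hd⟩ := ρ.2.1.1.nonempty
    have hdK := G.mem_edgesOf_edgeComponent d
    have hρK := ρ.2.1.1.subset_edgesOf hd hdK
    rcases hB.indicator_edgesOf hx hxB (G.edgeComponent d) with h | ⟨C, hC, hneg, a, ha, h⟩
    · refine ⟨0, fun e he => ?_⟩
      have h1 := congrFun h e
      rwa [Set.indicator_of_mem (hρK he)] at h1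
    · obtain ⟨t, ht⟩ := hneg.1.nonempty
      have hCρ : C = ρ.1 := hB.circle_unique hneg ρ.2.1 (hC.trans Set.inter_subset_left) ρ.2.2 ht
        hd (hC ht).2 hdK
      refine ⟨⟨a, ha⟩, fun e he => ?_⟩
      have h1 := congrFun h e
      rwa [Set.indicator_of_mem (hρK he), Set.indicator_of_mem (hCρ ▸ he)] at h1
  choose a ha using key
  refine ⟨a, funext fun e => ?_⟩
  rw [Finset.sum_apply]
  have heK := G.mem_edgesOf_edgeComponent e
  by_cases hex : ∃ ρ : G.BaseCircle B, e ∈ ρ.1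
  · obtain ⟨ρ, hρ⟩ := hex
    rw [Finset.sum_eq_single ρ, Set.indicator_of_mem hρ, ha ρ e hρ]
    · intro τ _ hτ
      refine Set.indicator_of_notMem (fun h => hτ (Subtype.ext ?_)) _
      exact hB.circle_unique τ.2.1 ρ.2.1 τ.2.2 ρ.2.2 h hρ heK heK
    · simp
  · rw [Finset.sum_eq_zero fun ρ _ => Set.indicator_of_notMem (fun h => hex ⟨ρ, h⟩) _]
    rcases hB.indicator_edgesOf hx hxB (G.edgeComponent e) with h | ⟨C, hC, hneg, a, ha, h⟩
    · have h1 := congrFun h e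
      rwa [Set.indicator_of_mem heK] at h1
    · have h1 := congrFun h e
      rwa [Set.indicator_of_mem heK, Set.indicator_of_notMem fun h' =>
        hex ⟨⟨C, hneg, hC.trans Set.inter_subset_left⟩, h'⟩] at h1

/-! ### The flow group in coordinates -/

theorem IsFundamentalFlow.eq_zero_of_ne {B : Set E} {e t : {e : E // e ∉ B}} {g : E → ℤ}
    (hg : G.IsFundamentalFlow B e.1 g) (ht : t ≠ e) : g t = 0 := by
  by_contra h
  exact (hg.support_subset h).elim (fun h => ht (Subtype.ext h)) t.2

theorem IsFundamentalFlow.mul_self {B : Set E} {e : E} {g : E → ℤ} (hg : G.IsFundamentalFlow B e g) :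
    g e * g e = 1 := by
  have := abs_mul_abs_self (g e)
  rw [hg.abs_self] at this
  rw [← this, one_mul]

theorem IsFundamentalFlow.bd_smul_const_eq_zero {B : Set E} {e : E} {g : E → ℤ}
    (hg : G.IsFundamentalFlow B e g) (a : A) : G.bd A (fun t => g t • a) = 0 := by
  ext v
  rw [bd_smul_const, hg.bd_eq]
  simp

variable (G A) in
/-- The combinations of the negative circles of `B`, with coefficients of order two, and of the
chains `f e`. -/
noncomputable def combination (B : Set E) [Fintype (G.BaseCircle B)] [Fintype {e : E // e ∉ B}]
    (f : {e : E // e ∉ B} → E → ℤ) :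
    (G.BaseCircle B → torTwo A) × ({e : E // e ∉ B} → A) →+ (E → A) where
  toFun p := ∑ ρ : G.BaseCircle B, (ρ.1.indicator fun _ => (p.1 ρ : A)) + ∑ e, fun t => f e t • p.2 e
  map_zero' := by
    ext t
    simp
  map_add' p q := by
    have h1 : ∀ ρ : G.BaseCircle B, (ρ.1.indicator fun _ => ((p + q).1 ρ : A)) =
        (ρ.1.indicator fun _ => (p.1 ρ : A)) + ρ.1.indicator fun _ => (q.1 ρ : A) := by
      intro ρ
      rw [← Set.indicator_add']
      rfl
    have h2 : ∀ e, (fun t => f e t • (p + q).2 e) =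
        (fun t => f e t • p.2 e) + fun t => f e t • q.2 e := by
      intro e
      ext t
      simp
    rw [Finset.sum_congr rfl fun ρ _ => h1 ρ, Finset.sum_congr rfl fun e _ => h2 e,
      Finset.sum_add_distrib, Finset.sum_add_distrib]
    abel

section Combination

variable {B : Set E} [Fintype (G.BaseCircle B)] [Fintype {e : E // e ∉ B}]
  {f : {e : E // e ∉ B} → E → ℤ}

-- Off `B` the fundamental flows form a diagonal matrix with entries ±1, so a combination can be
-- read off there.
omit [Fintype (G.BaseCircle B)] in
theorem sum_smul_apply (hf : ∀ e, G.IsFundamentalFlow B e.1 (f e)) (y : {e : E // e ∉ B} → A)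
    (e : {e : E // e ∉ B}) : (∑ d, fun t => f d t • y d) e.1 = f e e • y e := by
  rw [Finset.sum_apply, Finset.sum_eq_single e]
  · intro d _ hd
    rw [(hf d).eq_zero_of_ne (Ne.symm hd), zero_smul]
  · simp

/-- Values off `B` determine the coefficients of the fundamental flows; the circles of `B` are
pairwise disjoint and determine the rest. -/
theorem IsCanonicalBase.combination_injective [Fintype V] (hB : G.IsCanonicalBase B)
    (hf : ∀ e, G.IsFundamentalFlow B e.1 (f e)) :
    Function.Injective (G.combination A B f) := by
  rw [injective_iff_map_eq_zero]
  rintro ⟨a, y⟩ h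
  have hy : y = 0 := by
    ext e
    have h1 := congrFun h e.1
    simp only [combination, AddMonoidHom.coe_mk, ZeroHom.coe_mk, Pi.add_apply] at h1
    rw [sum_smul_apply hf, Finset.sum_apply, Finset.sum_eq_zero, zero_add, Pi.zero_apply] at h1
    · have h2 := congrArg (f e e • ·) h1
      simpa [smul_smul, (hf e).mul_self] using h2
    · exact fun ρ _ => Set.indicator_of_notMem (fun h => e.2 (ρ.2.2 h)) _
  subst hy
  refine Prod.ext (funext fun ρ => Subtype.ext ?_) rfl
  obtain ⟨t, ht⟩ := ρ.2.1.1.nonempty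
  have h1 := congrFun h t
  have htK := G.mem_edgesOf_edgeComponent t
  simp only [combination, AddMonoidHom.coe_mk, ZeroHom.coe_mk, Pi.add_apply] at h1
  rw [Finset.sum_apply, Finset.sum_apply, Finset.sum_eq_single ρ, Set.indicator_of_mem ht] at h1
  · simpa using h1
  · intro τ _ hτ
    refine Set.indicator_of_notMem (fun h => hτ (Subtype.ext ?_)) _
    exact hB.circle_unique τ.2.1 ρ.2.1 τ.2.2 ρ.2.2 h ht htK htK
  · simp

theorem bd_combination (hf : ∀ e, G.IsFundamentalFlow B e.1 (f e))
    (p : (G.BaseCircle B → torTwo A) × ({e : E // e ∉ B} → A)) :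
    G.bd A (G.combination A B f p) = 0 := by
  simp only [combination, AddMonoidHom.coe_mk, ZeroHom.coe_mk]
  rw [map_add, map_sum, map_sum, Finset.sum_eq_zero, Finset.sum_eq_zero, add_zero]
  · exact fun e _ => (hf e).bd_smul_const_eq_zero _
  · exact fun ρ _ => ρ.2.1.1.bd_indicator_torTwo (p.1 ρ).2

theorem IsCanonicalBase.exists_combination [Fintype V] (hB : G.IsCanonicalBase B)
    (hf : ∀ e, G.IsFundamentalFlow B e.1 (f e)) {x : E → A} (hx : G.bd A x = 0) :
    ∃ p, G.combination A B f p = x := by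
  set y : {e : E // e ∉ B} → A := fun e => f e e • x e with hy
  have hsum : G.bd A (∑ e, fun t => f e t • y e) = 0 := by
    rw [map_sum]
    exact Finset.sum_eq_zero fun e _ => (hf e).bd_smul_const_eq_zero _
  obtain ⟨a, ha⟩ := hB.exists_torTwo (x := x - ∑ e, fun t => f e t • y e)
    (by rw [map_sub, hx, hsum, sub_zero]) (fun t ht => by
      by_contra htB
      apply ht
      have h1 := sum_smul_apply hf y ⟨t, htB⟩
      rw [Pi.sub_apply, h1, hy]
      simp [smul_smul, (hf ⟨t, htB⟩).mul_self])
  exact ⟨(a, y), by simp [combination, ← ha]⟩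

end Combination

end SignedGraph

namespace SignedGraph

variable {V E : Type*} {G : SignedGraph V E}

/-! ### Chains and their coordinates -/

theorem arc_eq_opp_of_ne {e : E} {a b : G.Arc e} (h : a ≠ b) : a = b.opp :=
  (a.eq_or_eq_opp b).resolve_left h

open Classical in
variable (G) in
/-- The coordinates of a chain with respect to the reference orientation. -/
noncomputable def coord (A : Type*) [AddCommGroup A] : G.Chain A ≃+ (E → A) where
  toFun c e := c.1 e (G.refOrientation e)
  invFun x := ⟨fun e a => if a = G.refOrientation e then x e else - x e, by
    intro e a
    rcases a.eq_or_eq_opp (G.refOrientation e) with h | h <;> simp [h, Arc.opp_ne]⟩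
  left_inv c := by
    ext e a
    rcases a.eq_or_eq_opp (G.refOrientation e) with h | h
    · simp [h]
    · simp [h, Arc.opp_ne, c.2 e (G.refOrientation e)]
  right_inv x := by
    ext e
    simp
  map_add' c d := by
    ext e
    simp

theorem coord_apply {A : Type*} [AddCommGroup A] (c : G.Chain A) (e : E) :
    G.coord A c e = c.1 e (G.refOrientation e) := rfl

theorem chain_apply_of_ne {A : Type*} [AddCommGroup A] (c : G.Chain A) {e : E} {a : G.Arc e}
    (h : G.refOrientation e ≠ a) : c.1 e a = - G.coord A c e := by
  rw [coord_apply, arc_eq_opp_of_ne h, c.2 e a, neg_neg]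

theorem mem_flow_iff [Fintype E] {A : Type*} [AddCommGroup A] {c : G.Chain A} :
    c ∈ G.flow A ↔ G.bd A (G.coord A c) = 0 := Iff.rfl

theorem support_eq {A : Type*} [AddCommGroup A] (c : G.Chain A) :
    G.support c = Function.support (G.coord A c) := by
  ext e
  refine ⟨fun ⟨a, ha⟩ h => ha ?_, fun h => ⟨_, h⟩⟩
  by_cases hae : G.refOrientation e = a
  · rw [← hae]
    exact h
  · rw [chain_apply_of_ne c hae, h, neg_zero]

theorem coord_scale {A : Type*} [AddCommGroup A] (c : G.Chain ℤ) (a : A) (e : E) :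
    G.coord A (G.scale A c a) e = G.coord ℤ c e • a := rfl

open Classical in
theorem coord_multisetChain (S : Set E) (m : E → ℤ) (ω : G.Orientation) (e : E) :
    G.coord ℤ (G.multisetChain S m ω) e =
      if e ∈ S then (if G.refOrientation e = ω e then m e else - m e) else 0 := rfl

/-- Since `-a = a`, the chosen orientation is invisible. -/
theorem coord_scale_indicatorChain {A : Type*} [AddCommGroup A] (S : Set E) (ω : G.Orientation)
    {a : A} (ha : a ∈ torTwo A) :
    G.coord A (G.scale A (G.indicatorChain S ω) a) = S.indicator fun _ => a := by
  classical
  ext e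
  rw [coord_scale, indicatorChain, coord_multisetChain]
  by_cases he : e ∈ S
  · rw [if_pos he, Set.indicator_of_mem he]
    split_ifs
    · rw [one_smul]
    · rw [neg_smul, one_smul, neg_eq_of_mem_torTwo ha]
  · rw [if_neg he, Set.indicator_of_notMem he, zero_smul]

variable [Fintype E]

/-! ### Fundamental circuits -/

theorem IsFundamentalFlow.bd_real {B : Set E} {e : E} {f : E → ℤ}
    (hf : G.IsFundamentalFlow B e f) : G.bd ℝ (fun t => (f t : ℝ)) = 0 := by
  have h := hf.bd_smul_const_eq_zero (1 : ℝ)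
  simpa using h

theorem IsFundamentalFlow.mem_support {B : Set E} {e : E} {f : E → ℤ}
    (hf : G.IsFundamentalFlow B e f) : e ∈ Function.support f := fun h => by
  simpa [h] using hf.abs_self

/-- The real flows supported in `B ∪ {e}` are the multiples of the fundamental flow. -/
theorem IsCanonicalBase.eq_mul [Fintype V] {B : Set E} (hB : G.IsCanonicalBase B) {e : E}
    {f : E → ℤ} (hf : G.IsFundamentalFlow B e f) {x : E → ℝ} (hx : G.bd ℝ x = 0)
    (hxB : Function.support x ⊆ insert e B) : ∃ r : ℝ, x = fun t => (f t : ℝ) * r := by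
  -- The value `f e = ±1` is its own inverse, so this multiple of `f` agrees with `x` at `e`; the
  -- difference is a real flow inside `B`.
  refine ⟨f e * x e, ?_⟩
  rw [← sub_eq_zero]
  refine hB.eq_zero_of_support_subset ?_ fun t ht => ?_
  · have h1 : (fun t => (f t : ℝ) * (f e * x e)) = fun t => f t • ((f e : ℝ) * x e) := by
      ext t
      simp
    rw [map_sub, hx, h1, hf.bd_smul_const_eq_zero, sub_zero]
  · by_contra htB
    have hff : (f e : ℝ) * f e = 1 := by exact_mod_cast hf.mul_self
    apply ht
    by_cases hte : t = e
    · subst hte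
      simp [← mul_assoc, hff]
    · have h1 : x t = 0 := by
        by_contra h
        exact (hxB h).elim hte htB
      have h2 : f t = 0 := by
        by_contra h
        exact (hf.support_subset h).elim hte htB
      simp [h1, h2]

/-- A nonzero flow on `B ∪ {e}` is a nonzero multiple of `f`. This yields both minimality and
uniqueness of the fundamental circuit. -/
theorem IsCanonicalBase.eq_support [Fintype V] {B : Set E} (hB : G.IsCanonicalBase B) {e : E}
    {f : E → ℤ} (hf : G.IsFundamentalFlow B e f) {S : Set E} (hS : S.Nonempty)
    (hSB : S ⊆ insert e B) {g : G.Chain ℝ} (hg : g ∈ G.flow ℝ) (hgS : G.support g = S) :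
    S = Function.support f := by
  rw [support_eq] at hgS
  subst hgS
  obtain ⟨r, hr⟩ := hB.eq_mul hf (mem_flow_iff.1 hg) hSB
  have hr0 : r ≠ 0 := by
    rintro rfl
    obtain ⟨t, ht⟩ := hS
    exact ht (by simp [hr])
  ext t
  simp [hr, hr0]

theorem IsCanonicalBase.isFundamentalCircuit_iff [Fintype V] {B : Set E}
    (hB : G.IsCanonicalBase B) {e : E} {f : E → ℤ} (hf : G.IsFundamentalFlow B e f) {C : Set E} :
    G.IsFundamentalCircuit B e C ↔ C = Function.support f := by
  constructor
  · rintro ⟨⟨⟨hne, g, hg, hgC⟩, -⟩, hC⟩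
    exact hB.eq_support hf hne hC hg hgC
  · rintro rfl
    refine ⟨⟨⟨⟨e, hf.mem_support⟩, (G.coord ℝ).symm fun t => (f t : ℝ), ?_, ?_⟩, ?_⟩,
      hf.support_subset⟩
    · rw [mem_flow_iff, AddEquiv.apply_symm_apply, hf.bd_real]
    · rw [support_eq, AddEquiv.apply_symm_apply]
      ext t
      simp
    · rintro S ⟨hS, g, hg, hgS⟩ hSC
      exact (hB.eq_support hf hS (hSC.trans hf.support_subset) hg hgS).ge

/-- The circuit chain of a fundamental circuit is the fundamental flow, up to sign. -/
theorem IsCanonicalBase.coord_circuitChain [Fintype V] {B : Set E}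
    (hB : G.IsCanonicalBase B) {e : E} {f : E → ℤ} (hf : G.IsFundamentalFlow B e f)
    {η : G.Orientation} (hη : G.IsDirection (Function.support f) η) :
    ∃ s : ℤˣ, ∀ t, G.coord ℤ (G.circuitChain (Function.support f) η) t = s * f t := by
  classical
  obtain ⟨g, hg, hgf, hpos⟩ := hη
  rw [support_eq] at hgf
  obtain ⟨r, hr⟩ := hB.eq_mul hf (mem_flow_iff.1 hg) (hgf ▸ hf.support_subset)
  have hrt : ∀ t, G.coord ℝ g t = f t * r := congrFun hr
  -- Here `s` is the sign of `r`: as `g = r f` is positive along `η`, so is `s f`, whose absolute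
  -- values are the circuit multiplicities.
  have key : ∀ s : ℤˣ, 0 < (s : ℝ) * r →
      ∀ t, G.coord ℤ (G.circuitChain (Function.support f) η) t = s * f t := by
    intro s hs t
    rw [circuitChain, coord_multisetChain]
    by_cases ht : t ∈ Function.support f
    · rw [if_pos ht, ← hf.abs_eq t ht]
      have h1 := hpos t ht
      have hsr : (s : ℝ) * s = 1 := by
        rcases Int.units_eq_one_or s with h | h <;> simp [h]
      have hsf : (s : ℝ) * f t * (s * r) = f t * r := by
        linear_combination (f t : ℝ) * r * hsr
      have habs : |(s : ℤ) * f t| = |f t| := by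
        rcases Int.units_eq_one_or s with h | h <;> simp [h]
      split_ifs with hη
      · rw [← hη, ← coord_apply, hrt, ← hsf] at h1
        have h2 : 0 < (s : ℤ) * f t := by exact_mod_cast pos_of_mul_pos_left h1 hs.le
        rw [← habs, abs_of_pos h2]
      · rw [chain_apply_of_ne g hη, hrt, ← hsf, ← neg_mul] at h1
        have h2 : 0 < -((s : ℤ) * f t) := by exact_mod_cast pos_of_mul_pos_left h1 hs.le
        rw [← habs, abs_of_neg (by linarith), neg_neg]
    · rw [if_neg ht, Function.notMem_support.1 ht, mul_zero]
  have hr0 : r ≠ 0 := by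
    rintro rfl
    have h1 := hgf.ge hf.mem_support
    exact h1 (by simp [hr])
  rcases lt_or_gt_of_ne hr0 with h | h
  · exact ⟨-1, key (-1) (by simpa using h)⟩
  · exact ⟨1, key 1 (by simpa using h)⟩

theorem _root_.AddSubgroup.iSupIndep_of_sum_eq_zero {ι X : Type*} [Fintype ι] [AddCommGroup X]
    {N : ι → AddSubgroup X}
    (h : ∀ n : ι → X, (∀ i, n i ∈ N i) → ∑ i, n i = 0 → n = 0) : iSupIndep N := by
  classical
  refine iSupIndep_of_dfinsuppSumAddHom_injective' N ((injective_iff_map_eq_zero _).2 fun v hv => ?_)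
  rw [DFinsupp.sumAddHom_apply, DFinsupp.sum_eq_sum_fintype _ fun i => by simp] at hv
  have h1 := h (fun i => v i) (fun i => (v i).2) hv
  ext i
  exact congrFun h1 i

end SignedGraph

/-! ### Assembling the theorem -/

open SignedGraph in
theorem mainTheorem1 {V E : Type*} [Fintype V] [Fintype E] (G : SignedGraph V E)
    (A : Type*) [AddCommGroup A] (B : Set E) (hB : G.IsCanonicalBase B) :
    (∀ e ∉ B, ∃! C : Set E, G.IsFundamentalCircuit B e C) ∧
    (∀ (ω : {ρ : Set E // G.IsNegativeCircle ρ ∧ ρ ⊆ B} → G.Orientation)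
        (C : {e : E // e ∉ B} → Set E) (η : {e : E // e ∉ B} → G.Orientation),
      (∀ e, G.IsFundamentalCircuit B e.1 (C e)) → (∀ e, G.IsDirection (C e) (η e)) →
      let N : {ρ : Set E // G.IsNegativeCircle ρ ∧ ρ ⊆ B} ⊕ {e : E // e ∉ B} →
          AddSubgroup (G.Chain A) :=
        Sum.elim
          (fun ρ => (SignedGraph.torTwo A).map (G.scale A (G.indicatorChain ρ.1 (ω ρ))))
          (fun e => (G.scale A (G.circuitChain (C e) (η e))).range)
      G.flow A = iSup N ∧ iSupIndep N) ∧
    G.cycleRank = Nat.card {e : E // e ∉ B} ∧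
    Nonempty (G.flow A ≃+
      (Fin G.numCompactUnbalanced → SignedGraph.torTwo A) × (Fin G.cycleRank → A)) := by
  classical
  have hex : ∀ e : {e : E // e ∉ B}, ∃ f, G.IsFundamentalFlow B e.1 f :=
    fun e => hB.exists_isFundamentalFlow e.2
  choose f hf using hex
  refine ⟨fun e he => ⟨_, (hB.isFundamentalCircuit_iff (hf ⟨e, he⟩)).2 rfl, fun C hC =>
    (hB.isFundamentalCircuit_iff (hf ⟨e, he⟩)).1 hC⟩, ?_, hB.cycleRank_eq, ?_⟩
  · intro ω C η hC hη N
    obtain rfl : C = fun e => Function.support (f e) :=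
      funext fun e => (hB.isFundamentalCircuit_iff (hf e)).1 (hC e)
    have hs := fun e => hB.coord_circuitChain (hf e) (hη e)
    choose s hs using hs
    have hNl : ∀ ρ : G.BaseCircle B, ∀ c, c ∈ N (Sum.inl ρ) ↔
        ∃ a : torTwo A, G.coord A c = ρ.1.indicator fun _ => (a : A) := by
      intro ρ c
      constructor
      · rintro ⟨a, ha, rfl⟩
        exact ⟨⟨a, ha⟩, coord_scale_indicatorChain _ _ ha⟩
      · rintro ⟨a, ha⟩
        refine ⟨a, a.2, (G.coord A).injective ?_⟩
        rw [ha, coord_scale_indicatorChain _ _ a.2]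
    have hsmul : ∀ e (a : A), G.coord A (G.scale A (G.circuitChain (Function.support (f e)) (η e)) a)
        = fun t => f e t • ((s e : ℤ) • a) := by
      intro e a
      ext t
      rw [coord_scale, hs, mul_comm, mul_smul]
    -- The sign `s e` is absorbed by replacing `a` with `s e • a`, so the summand does not depend on
    -- the chosen direction.
    have hNr : ∀ e c, c ∈ N (Sum.inr e) ↔ ∃ a : A, G.coord A c = fun t => f e t • a := by
      intro e c
      constructor
      · rintro ⟨a, rfl⟩
        exact ⟨_, hsmul e a⟩
      · rintro ⟨a, ha⟩
        refine ⟨(s e : ℤ) • a, (G.coord A).injective ?_⟩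
        have h1 : (s e : ℤ) * s e = 1 := by
          rcases Int.units_eq_one_or (s e) with h | h <;> simp [h]
        rw [ha, hsmul, smul_smul, h1, one_smul]
    refine ⟨le_antisymm (fun c hc => ?_) (iSup_le ?_), ?_⟩
    · obtain ⟨p, hp⟩ := hB.exists_combination hf (mem_flow_iff.1 hc)
      have h1 : c = ∑ ρ : G.BaseCircle B, (G.coord A).symm (ρ.1.indicator fun _ => (p.1 ρ : A)) +
          ∑ e, (G.coord A).symm fun t => f e t • p.2 e := by
        apply (G.coord A).injective
        rw [map_add, map_sum, map_sum, ← hp]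
        simp [combination]
      rw [h1]
      refine add_mem (sum_mem fun ρ _ => ?_) (sum_mem fun e _ => ?_)
      · exact AddSubgroup.mem_iSup_of_mem (Sum.inl ρ) ((hNl ρ _).2 ⟨p.1 ρ, by simp⟩)
      · exact AddSubgroup.mem_iSup_of_mem (Sum.inr e) ((hNr e _).2 ⟨p.2 e, by simp⟩)
    · rintro (ρ | e) c hc
      · obtain ⟨a, ha⟩ := (hNl ρ c).1 hc
        rw [mem_flow_iff, ha]
        exact ρ.2.1.1.bd_indicator_torTwo a.2
      · obtain ⟨a, ha⟩ := (hNr e c).1 hc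
        rw [mem_flow_iff, ha]
        exact (hf e).bd_smul_const_eq_zero a
    · refine AddSubgroup.iSupIndep_of_sum_eq_zero fun n hn hsum => ?_
      choose a ha using fun ρ => (hNl ρ _).1 (hn (Sum.inl ρ))
      choose y hy using fun e => (hNr e _).1 (hn (Sum.inr e))
      have h1 : G.combination A B f (a, y) = 0 := by
        have h2 := congrArg (G.coord A) hsum
        rw [Fintype.sum_sum_type, map_add, map_sum, map_sum, map_zero] at h2
        rw [← h2]
        simp only [combination, AddMonoidHom.coe_mk, ZeroHom.coe_mk, ha, hy]
      have h2 := hB.combination_injective hf (h1.trans (map_zero _).symm)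
      obtain ⟨rfl, rfl⟩ := Prod.ext_iff.1 h2
      ext1 i
      apply (G.coord A).injective
      rcases i with ρ | e
      · rw [ha]
        ext t
        simp
      · rw [hy]
        ext t
        simp
  -- In coordinates the flow group is the range of the injective map `combination`, whose domain has
  -- the required ranks.
  · let φ : G.flow A ≃+ (G.combination A B f).range :=
      { toFun c := ⟨G.coord A c.1, hB.exists_combination hf (mem_flow_iff.1 c.2)⟩
        invFun x := ⟨(G.coord A).symm x.1, by
          obtain ⟨p, hp⟩ := x.2
          rw [mem_flow_iff, AddEquiv.apply_symm_apply, ← hp, bd_combination hf]⟩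
        left_inv c := by simp
        right_inv x := by simp
        map_add' c d := by
          ext
          simp }
    have e₁ : G.BaseCircle B ≃ Fin G.numCompactUnbalanced :=
      Finite.equivFinOfCardEq hB.card_baseCircle
    have e₂ : {e : E // e ∉ B} ≃ Fin G.cycleRank := Finite.equivFinOfCardEq hB.cycleRank_eq.symm
    exact ⟨(φ.trans (AddMonoidHom.ofInjective (hB.combination_injective hf)).symm).trans
      (AddEquiv.prodCongr (AddEquiv.arrowCongr e₁ (AddEquiv.refl (torTwo A)))
        (AddEquiv.arrowCongr e₂ (AddEquiv.refl A)))⟩
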